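/- Let $\tilde F(z)=\sum_{k=0}^\infty f_kz^k$ be a real entire function (all $f_k\in\mathbb R$) of genus at most one, with $f_0>0$, and suppose that the functions $\sum_{k\ge0} f_{2k}z^k$ and $\sum_{k\ge0} f_{2k+1}z^k$ have only negative zeros (so that, in particular, $f_1\neq0$). Let $\alpha\in\mathbb C\setminus\{0\}$, let $\mu\in\mathbb C$ be a square root of $i$ (that is, $\mu^2=i$), let $s=\operatorname{sign} f_1\in\{1,-1\}$, and put $$G(z)=\alpha\sum_{k=0}^\infty i^{\frac{k(k-1)}2}f_kz^k,\qquad \overline G(z)=\overline\alpha\sum_{k=0}^\infty i^{-\frac{k(k-1)}2}f_kz^k .$$ Denote by $Q_1,Q_2,Q_3,Q_4$ the open quadrants of $\mathbb C$, numbered counterclockwise from $Q_1=\{\Re z>0,\ \Im z>0\}$. (a) Let $F(z)=G(\overline\mu z)$ and $c=-s\,\overline\mu$, so that $\Im c^2<0$. Then $F(z)=f(z^2)+z\,g(z^2)$, where $f,g$ are entire functions of genus $0$, all zeros of $f$ are negative, all zeros of $g$ are positive, and $c=-\dfrac{g(0)\,|f(0)|}{f(0)\,|g(0)|}$. The function $F$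 has at least one zero. All its zeros are simple and can be numbered $z_1,z_2,\dots$ (a finite or infinite list) so that $0<|z_1|<|z_2|<\cdots$. Here $\Im z_k^2\ne0$ for every $k$; if $z_k\in Q_l$ with $l\in\{2,3,4\}$, then $z_{k+1}\in Q_{l-1}$, and if $z_k\in Q_1$, then $z_{k+1}\in Q_4$ (whenever $z_{k+1}$ exists). Moreover, $\Im c\,\Im z_1<0$ and $\Re z_1\,\Im z_1>0$. (b) Let $F(z)=\overline G(\mu z)$ and $c=-s\,\mu$, so that $\Im c^2>0$. Then $F(z)=f(z^2)+z\,g(z^2)$ with $f$, $g$, $c$ related as in (a). The function $F$ has at least one zero. All its zeros are simple and can be numbered $z_1,z_2,\dots$ (a finite or infinite list) so that $0<|z_1|<|z_2|<\cdots$. Here $\Im z_k^2\ne0$ for every $k$; if $z_k\in Q_l$ with $l\in\{1,2,3\}$, then $z_{k+1}\in Q_{l+1}$, and if $z_k\in Q_4$, then $z_{k+1}\in Q_1$ (whenever $z_{k+1}$ exists). Moreover, $\Re c\,\Re z_1>0$ and $\Re z_1\,\Im z_1<0$. -/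

import Mathlib

open scoped ComplexConjugate

noncomputable section

/-- The Weierstrass elementary factor `E_p(u) = (1 - u) exp (u + u²/2 + ⋯ + u^p/p)`. -/
def weierstrassFactor (p : ℕ) (u : ℂ) : ℂ :=
  (1 - u) * Complex.exp (∑ j ∈ Finset.Icc 1 p, u ^ j / (j : ℂ))

/-- `F` is an entire function (not identically zero) of genus at most `p`:
`F(z) = z^m e^{P(z)} ∏ₖ E_p(z / aₖ)` with `deg P ≤ p` and `∑ₖ |aₖ|^{-(p+1)} < ∞`.
The `aₖ` are the nonzero zeros of `F`, finitely or infinitely many. The sequence `w` consists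
of the reciprocals `1 / aₖ`; it may also contain zeros, for which the factor is `E_p(0) = 1`. -/
def HasGenusAtMost (p : ℕ) (F : ℂ → ℂ) : Prop :=
  ∃ (m : ℕ) (P : Polynomial ℂ) (w : ℕ → ℂ),
    P.natDegree ≤ p ∧ Summable (fun k => ‖w k‖ ^ (p + 1)) ∧
    ∀ z : ℂ, ∃ t : ℂ, HasProd (fun k => weierstrassFactor p (w k * z)) t ∧
      F z = z ^ m * Complex.exp (P.eval z) * t

/-- The open quadrants of the plane, numbered counterclockwise: the indices `0, 1, 2, 3` stand for
the first, second, third and fourth quadrant. Adding `1` to the index (cyclically) is a step to the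
next quadrant counterclockwise. -/
def quadrant : Fin 4 → Set ℂ :=
  ![{z | 0 < z.re ∧ 0 < z.im}, {z | z.re < 0 ∧ 0 < z.im},
    {z | z.re < 0 ∧ z.im < 0}, {z | 0 < z.re ∧ z.im < 0}]

/-- `z 0, z 1, z 2, …` (the terms `z k` with `k < ω`, where `1 ≤ ω ≤ ∞`) is the list of all zeros
of the entire function `F`, each repeated as many times as its multiplicity. -/
structure IsZeroList (F : ℂ → ℂ) (ω : ℕ∞) (z : ℕ → ℂ) : Prop where
  entire : Differentiable ℂ F
  one_le : 1 ≤ ω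
  multiplicity : ∀ a : ℂ, {k : ℕ | (k : ℕ∞) < ω ∧ z k = a}.encard = analyticOrderAt F a

/-- What the distributions below have in common: the zeros are simple, their moduli are positive
and strictly increasing, and no zero is real or purely imaginary. -/
structure SeparatedZeros (F : ℂ → ℂ) (ω : ℕ∞) (z : ℕ → ℂ) : Prop extends IsZeroList F ω z where
  simple : ∀ k : ℕ, (k : ℕ∞) < ω → analyticOrderAt F (z k) = 1
  pos : 0 < ‖z 0‖
  strict : ∀ k : ℕ, ((k + 1 : ℕ) : ℕ∞) < ω → ‖z k‖ < ‖z (k + 1)‖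
  off_axes : ∀ k : ℕ, (k : ℕ∞) < ω → ((z k) ^ 2).im ≠ 0

/-- Distribution of the zeros of `F` that belongs to a constant `c` with `Im c² > 0`: each zero lies
in the quadrant next (counterclockwise) to that of its predecessor; the position of the first zero
is determined by `c`. -/
def CounterclockwiseZeros (F : ℂ → ℂ) (c : ℂ) : Prop :=
  ∃ (ω : ℕ∞) (z : ℕ → ℂ), SeparatedZeros F ω z ∧
    (∀ (k : ℕ) (l : Fin 4), ((k + 1 : ℕ) : ℕ∞) < ω → z k ∈ quadrant l →
      z (k + 1) ∈ quadrant (l + 1)) ∧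
    0 < c.re * (z 0).re ∧ (z 0).re * (z 0).im < 0

/-- Distribution of the zeros of `F` that belongs to a constant `c` with `Im c² < 0`: each zero lies
in the quadrant next (clockwise) to that of its predecessor; the position of the first zero is
determined by `c`. -/
def ClockwiseZeros (F : ℂ → ℂ) (c : ℂ) : Prop :=
  ∃ (ω : ℕ∞) (z : ℕ → ℂ), SeparatedZeros F ω z ∧
    (∀ (k : ℕ) (l : Fin 4), ((k + 1 : ℕ) : ℕ∞) < ω → z k ∈ quadrant l →
      z (k + 1) ∈ quadrant (l - 1)) ∧
    c.im * (z 0).im < 0 ∧ 0 < (z 0).re * (z 0).im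

/-- `F(z) = f(z²) + z g(z²)` with entire functions `f`, `g` of genus `0` such that all zeros of `f`
are negative, all zeros of `g` are positive, and `c = - g(0)|f(0)| / (f(0)|g(0)|)`. -/
def HasSplittingWithConstant (F : ℂ → ℂ) (c : ℂ) : Prop :=
  ∃ f g : ℂ → ℂ, HasGenusAtMost 0 f ∧ HasGenusAtMost 0 g ∧
    (∀ z, f z = 0 → ∃ x : ℝ, x < 0 ∧ z = x) ∧
    (∀ z, g z = 0 → ∃ x : ℝ, 0 < x ∧ z = x) ∧
    (∀ z, F z = f (z ^ 2) + z * g (z ^ 2)) ∧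
    c = -(g 0 * ‖f 0‖) / (f 0 * ‖g 0‖)

/-- `G(z) = α ∑ₖ i^{k(k-1)/2} fₖ z^k`. -/
def rotatedSeries (α : ℂ) (f : ℕ → ℝ) (z : ℂ) : ℂ :=
  α * ∑' k : ℕ, Complex.I ^ (k * (k - 1) / 2) * (f k : ℂ) * z ^ k

/-- The conjugate function `Ḡ(z) = ᾱ ∑ₖ i^{-k(k-1)/2} fₖ z^k`. -/
def rotatedSeriesConj (α : ℂ) (f : ℕ → ℝ) (z : ℂ) : ℂ :=
  conj α * ∑' k : ℕ, (Complex.I ^ (k * (k - 1) / 2))⁻¹ * (f k : ℂ) * z ^ k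

end

open Filter Topology

/-! Split `Ft` as E(z²) + z O(z²). Genus at most one gives |Ft(z)| ≤ C exp(ε|z|²) for every ε > 0,
so E and O have minimal exponential type. Their zeros are negative, hence by Hadamard
(`exists_hasProd_of_zeros_neg`) E = f₀X and O = f₁Y with X(w) = ∏(1 + xₖw), Y(w) = ∏(1 + yₖw) and
summable xₖ, yₖ ≥ 0. The weights i^{k(k-1)/2} and the rotation by μ̄ turn the series into α(f₀X(z²)
+ μ̄f₁ z Y(-z²)). Up to a constant factor and the sign of z this is X(z²) - q e^{-iπ/4} z Y(-z²)
with q = |f₁|/f₀ (`splitProd`). Part (b) reduces to the same function by conjugation.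

X and Y are real on the real axis, so each of the symmetries z, z̄, -z, -z̄ moves a zero to a
solution in the first quadrant of X(z²) = q e^{iτ} z Y(-z²), where τ = -π/4 + kπ/2 and k mod 4
counts quadrants clockwise. Put w = z², a point of the upper half plane. On a semicircle |w| = r the
modulus of X(w) decreases with the angle and that of Y(-w) increases (one of them strictly, unless X
= Y = 1), so both sides have equal modulus at no more than one angle θ(r). Clamped to [0, π], θ is
continuous in r. Let A(r) be the argument of X(w)/(√w Y(-w)) along this curve; the zeros are the
radii with A(r) ≡ τ mod 2π (`IsLevelAngle.eq_iff`).

A can cross a level τ only upwards. At the ends θ = 0, π it is a multiple of π/2, so no level is met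
there. Inside, the quotient has constant modulus along the curve, and its logarithmic derivative
with respect to log w has positive imaginary part, because Im(wX'/X) is a sum of terms with the sign
of Im w (`IsLevelAngle.eventually_levelArg_lt`). So each level is attained at most once
(`IsLevelAngle.lt_levelArg_of_le`). Since A < -π/4 for small r, A > -π/4 somewhere, and A ≥ -π/2
always, the levels k = 0, 1, 2, … are met in this order at increasing radii, finitely or infinitely
many of them: a clockwise walk that begins in the first quadrant. -/

/-! ### Growth of functions of genus at most one -/

theorem norm_weierstrassFactor_one_le_exp (u : ℂ) :
    ‖weierstrassFactor 1 u‖ ≤ Real.exp (2 * ‖u‖) := by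
  have h : weierstrassFactor 1 u = (1 - u) * Complex.exp u := by simp [weierstrassFactor]
  rw [h, norm_mul, two_mul, Real.exp_add]
  refine mul_le_mul ?_ (Complex.norm_exp_le_exp_norm u) (norm_nonneg _) (Real.exp_pos _).le
  calc ‖1 - u‖ ≤ ‖(1 : ℂ)‖ + ‖u‖ := norm_sub_le _ _
    _ = ‖u‖ + 1 := by rw [norm_one, add_comm]
    _ ≤ Real.exp ‖u‖ := Real.add_one_le_exp _

/-- The exponential cancels the linear term of 1 - u. The quadratic bound serves the tail of the
product, the linear bound above its finitely many leading factors. -/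
theorem norm_weierstrassFactor_one_le_exp_sq (u : ℂ) :
    ‖weierstrassFactor 1 u‖ ≤ Real.exp (3 * ‖u‖ ^ 2) := by
  rcases le_total ‖u‖ 1 with hu | hu
  · have h : weierstrassFactor 1 u = 1 - u ^ 2 + (1 - u) * (Complex.exp u - 1 - u) := by
      simp [weierstrassFactor]; ring
    have h1 : ‖1 - u‖ ≤ 2 := (norm_sub_le _ _).trans (by rw [norm_one]; linarith)
    have h2 := Complex.norm_exp_sub_one_sub_id_le hu
    calc ‖weierstrassFactor 1 u‖ ≤ 1 + ‖u‖ ^ 2 + 2 * ‖u‖ ^ 2 := by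
          rw [h]
          refine (norm_add_le _ _).trans (add_le_add ((norm_sub_le _ _).trans (by simp)) ?_)
          rw [norm_mul]
          gcongr
      _ = 3 * ‖u‖ ^ 2 + 1 := by ring
      _ ≤ _ := Real.add_one_le_exp _
  · refine (norm_weierstrassFactor_one_le_exp u).trans (Real.exp_le_exp.2 ?_)
    nlinarith

/-- A function of genus at most one has at most minimal type of order two. -/
theorem HasGenusAtMost.exists_norm_le_exp_sq {F : ℂ → ℂ} (hF : HasGenusAtMost 1 F)
    {ε : ℝ} (hε : 0 < ε) : ∃ C : ℝ, ∀ z, ‖F z‖ ≤ C * Real.exp (ε * ‖z‖ ^ 2) := by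
  obtain ⟨m, P, w, hP, hw, hprod⟩ := hF
  -- Outside `S` the factors contribute at most 3·(ε/6)|z|² = (ε/2)|z|² to the exponent; those in
  -- `S` contribute only a linear term.
  obtain ⟨S, hS⟩ := summable_iff_vanishing_norm.1 hw (ε / 6) (by positivity)
  set B : ℝ := 2 * ∑ k ∈ S, ‖w k‖
  have hbound : ∀ z t, HasProd (fun k => weierstrassFactor 1 (w k * z)) t →
      ‖t‖ ≤ Real.exp (B * ‖z‖ + ε / 2 * ‖z‖ ^ 2) := by
    intro z t ht
    refine le_of_tendsto' ht.norm fun s => ?_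
    have hs : ∀ k ∈ s, ‖weierstrassFactor 1 (w k * z)‖ ≤
        Real.exp (if k ∈ S then 2 * ‖w k‖ * ‖z‖ else 3 * ‖z‖ ^ 2 * ‖w k‖ ^ 2) := by
      intro k _
      split_ifs
      · simpa [mul_assoc] using norm_weierstrassFactor_one_le_exp (w k * z)
      · refine (norm_weierstrassFactor_one_le_exp_sq (w k * z)).trans_eq ?_
        rw [norm_mul]; ring_nf
    refine (Finset.prod_le_prod (fun _ _ => norm_nonneg _) hs).trans ?_
    rw [← Real.exp_sum, Real.exp_le_exp, Finset.sum_ite, ← Finset.mul_sum, ← Finset.sum_mul,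
      ← Finset.mul_sum]
    refine add_le_add ?_ ?_
    · refine mul_le_mul_of_nonneg_right ?_ (norm_nonneg _)
      refine mul_le_mul_of_nonneg_left ?_ zero_le_two
      exact Finset.sum_le_sum_of_subset_of_nonneg (fun k hk => (Finset.mem_filter.1 hk).2)
        fun _ _ _ => norm_nonneg _
    · have h := hS (s.filter fun k => k ∉ S)
        (Finset.disjoint_left.2 fun k hk => (Finset.mem_filter.1 hk).2)
      rw [Real.norm_eq_abs] at h
      have h' := (le_abs_self _).trans h.le
      norm_num at h'
      nlinarith [sq_nonneg ‖z‖]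
  set D : ℝ := m + ‖P.coeff 1‖ + B
  refine ⟨Real.exp (‖P.coeff 0‖ + D ^ 2 / (2 * ε)), fun z => ?_⟩
  obtain ⟨t, ht, hFz⟩ := hprod z
  have hPz : P.eval z = P.coeff 1 * z + P.coeff 0 := by
    conv_lhs => rw [Polynomial.eq_X_add_C_of_natDegree_le_one hP]
    simp
  have h1 : ‖z ^ m‖ ≤ Real.exp (m * ‖z‖) := by
    rw [norm_pow, Real.exp_nat_mul]
    exact pow_le_pow_left₀ (norm_nonneg _) ((lt_add_one _).le.trans (Real.add_one_le_exp _)) _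
  have h2 : ‖Complex.exp (P.eval z)‖ ≤ Real.exp (‖P.coeff 1‖ * ‖z‖ + ‖P.coeff 0‖) := by
    refine (Complex.norm_exp_le_exp_norm _).trans (Real.exp_le_exp.2 ?_)
    rw [hPz, ← norm_mul]
    exact norm_add_le _ _
  calc ‖F z‖ = ‖z ^ m‖ * ‖Complex.exp (P.eval z)‖ * ‖t‖ := by rw [hFz, norm_mul, norm_mul]
    _ ≤ Real.exp (m * ‖z‖) * Real.exp (‖P.coeff 1‖ * ‖z‖ + ‖P.coeff 0‖) *
        Real.exp (B * ‖z‖ + ε / 2 * ‖z‖ ^ 2) := by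
      have := hbound z t ht
      gcongr
    _ = Real.exp (‖P.coeff 0‖ + (D * ‖z‖ + ε / 2 * ‖z‖ ^ 2)) := by
      rw [← Real.exp_add, ← Real.exp_add]; congr 1; ring
    _ ≤ Real.exp (‖P.coeff 0‖ + D ^ 2 / (2 * ε) + ε * ‖z‖ ^ 2) := by
      refine Real.exp_le_exp.2 ?_
      -- All linear terms are absorbed by the other half of ε, by completing the square.
      have : D * ‖z‖ ≤ D ^ 2 / (2 * ε) + ε / 2 * ‖z‖ ^ 2 := by
        have h := sq_nonneg (D - ε * ‖z‖)
        have : D ^ 2 / (2 * ε) + ε / 2 * ‖z‖ ^ 2 - D * ‖z‖ = (D - ε * ‖z‖) ^ 2 / (2 * ε) := by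
          field_simp; ring
        have := div_nonneg h (by positivity : 0 ≤ 2 * ε)
        linarith
      linarith
    _ = _ := by rw [Real.exp_add]

/-! ### Even and odd parts of a power series -/

theorem differentiable_tsum_mul_pow {a : ℕ → ℂ}
    (ha : ∀ w : ℂ, Summable fun k => a k * w ^ k) :
    Differentiable ℂ fun w => ∑' k, a k * w ^ k := by
  intro w
  have h := (ha ((‖w‖ + 1 : ℝ) : ℂ)).norm
  refine (Complex.differentiableOn_tsum_of_summable_norm h (U := Metric.ball 0 (‖w‖ + 1))
    (fun k => by fun_prop) Metric.isOpen_ball fun k z hz => ?_).differentiableAt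
    (Metric.isOpen_ball.mem_nhds (by simp))
  rw [norm_mul, norm_mul, norm_pow, norm_pow]
  have hz' : ‖z‖ ≤ ‖((‖w‖ + 1 : ℝ) : ℂ)‖ := by
    rw [Complex.norm_real, Real.norm_of_nonneg (by positivity)]
    simpa using (mem_ball_zero_iff.1 hz).le
  gcongr

theorem summable_even_of_summable {a : ℕ → ℂ} (ha : ∀ w : ℂ, Summable fun k => a k * w ^ k)
    (w : ℂ) : Summable fun k => a (2 * k) * w ^ k := by
  obtain ⟨z, rfl⟩ := IsAlgClosed.exists_pow_nat_eq w two_pos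
  simpa [Function.comp_def, pow_mul] using
    (ha z).comp_injective (mul_right_injective₀ (two_ne_zero' ℕ))

theorem summable_odd_of_summable {a : ℕ → ℂ} (ha : ∀ w : ℂ, Summable fun k => a k * w ^ k)
    (w : ℂ) : Summable fun k => a (2 * k + 1) * w ^ k := by
  obtain ⟨z, rfl⟩ := IsAlgClosed.exists_pow_nat_eq w two_pos
  by_cases hz : z = 0
  · refine summable_of_ne_finset_zero (s := {0}) fun k hk => ?_
    have : k ≠ 0 := by simpa using hk
    simp [hz, this]
  · have h := (ha z).comp_injective (i := fun k => 2 * k + 1) fun _ _ h => by simpa using h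
    refine (h.mul_right z⁻¹).congr fun k => ?_
    simp only [Function.comp_apply, pow_succ, pow_mul]
    field_simp

theorem tsum_even_add_odd_mul_pow {a : ℕ → ℂ} {F : ℂ → ℂ}
    (hF : ∀ w : ℂ, HasSum (fun k => a k * w ^ k) (F w)) (z : ℂ) :
    F z = ∑' k, a (2 * k) * (z ^ 2) ^ k + z * ∑' k, a (2 * k + 1) * (z ^ 2) ^ k := by
  have ha := fun w => (hF w).summable
  refine (hF z).unique (HasSum.even_add_odd ?_ ?_)
  · simpa [pow_mul] using (summable_even_of_summable ha (z ^ 2)).hasSum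
  · refine ((summable_odd_of_summable ha (z ^ 2)).hasSum.mul_left z).congr_fun ?_ 
    intro k
    ring

theorem exists_even_norm_le_exp {F E O : ℂ → ℂ} (hFEO : ∀ z, F z = E (z ^ 2) + z * O (z ^ 2))
    (hF : ∀ ε > 0, ∃ C : ℝ, ∀ z, ‖F z‖ ≤ C * Real.exp (ε * ‖z‖ ^ 2)) :
    ∀ ε > 0, ∃ C : ℝ, ∀ w, ‖E w‖ ≤ C * Real.exp (ε * ‖w‖) := by
  intro ε hε
  obtain ⟨C, hC⟩ := hF ε hε
  refine ⟨C, fun w => ?_⟩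
  obtain ⟨z, rfl⟩ := IsAlgClosed.exists_pow_nat_eq w two_pos
  have h : E (z ^ 2) = (F z + F (-z)) / 2 := by rw [hFEO, hFEO, neg_sq]; ring
  have h1 := hC z
  have h2 := hC (-z)
  rw [norm_neg] at h2
  rw [h, norm_div, Complex.norm_ofNat, norm_pow]
  linarith [norm_add_le (F z) (F (-z))]

/-- z O(z²) = (F(z) - F(-z))/2, and division by z is harmless for |z| ≥ 1; the unit disc is covered
by compactness. -/
theorem exists_odd_norm_le_exp {F E O : ℂ → ℂ} (hFEO : ∀ z, F z = E (z ^ 2) + z * O (z ^ 2))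
    (hO : Continuous O)
    (hF : ∀ ε > 0, ∃ C : ℝ, ∀ z, ‖F z‖ ≤ C * Real.exp (ε * ‖z‖ ^ 2)) :
    ∀ ε > 0, ∃ C : ℝ, ∀ w, ‖O w‖ ≤ C * Real.exp (ε * ‖w‖) := by
  intro ε hε
  obtain ⟨C, hC⟩ := hF ε hε
  obtain ⟨M, hM⟩ := (isCompact_closedBall (0 : ℂ) 1).exists_bound_of_continuousOn hO.continuousOn
  have hC0 : 0 ≤ C := by
    have := (norm_nonneg _).trans (hC 0)
    simpa using this
  refine ⟨C + |M|, fun w => ?_⟩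
  have hexp : 1 ≤ Real.exp (ε * ‖w‖) := Real.one_le_exp (by positivity)
  rcases le_total ‖w‖ 1 with hw | hw
  · calc ‖O w‖ ≤ M := hM w (by simpa using hw)
      _ ≤ (C + |M|) * 1 := by linarith [le_abs_self M]
      _ ≤ _ := by gcongr
  · obtain ⟨z, rfl⟩ := IsAlgClosed.exists_pow_nat_eq w two_pos
    have hz : 1 ≤ ‖z‖ := by
      rw [norm_pow] at hw
      by_contra! h
      nlinarith [norm_nonneg z]
    have h : z * O (z ^ 2) = (F z - F (-z)) / 2 := by rw [hFEO, hFEO, neg_sq]; ring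
    have h1 := hC z
    have h2 := hC (-z)
    rw [norm_neg] at h2
    calc ‖O (z ^ 2)‖ ≤ ‖z‖ * ‖O (z ^ 2)‖ := le_mul_of_one_le_left (norm_nonneg _) hz
      _ = ‖(F z - F (-z)) / 2‖ := by rw [← h, norm_mul]
      _ ≤ C * Real.exp (ε * ‖z‖ ^ 2) := by
        rw [norm_div, Complex.norm_ofNat]
        linarith [norm_sub_le (F z) (F (-z))]
      _ ≤ _ := by
        rw [norm_pow]
        gcongr
        linarith [abs_nonneg M]

/-! ### Hadamard factorization for negative zeros -/

theorem exists_eq_sub_pow_mul {g : ℂ → ℂ} (hg : Differentiable ℂ g) {u : ℂ}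
    (hu : analyticOrderAt g u ≠ ⊤) :
    ∃ h : ℂ → ℂ, Differentiable ℂ h ∧ h u ≠ 0 ∧
      ∀ z, g z = (z - u) ^ analyticOrderNatAt g u * h z := by
  classical
  set n := analyticOrderNatAt g u
  obtain ⟨k, hk, hku, hgk⟩ := (hg.analyticAt u).analyticOrderAt_ne_top.1 hu
  have hgu : g u = (u - u) ^ n * k u := hgk.self_of_nhds
  refine ⟨fun z => if z = u then k u else g z / (z - u) ^ n, fun z => ?_, by simpa using hku,
    fun z => ?_⟩
  · by_cases hz : z = u
    · subst hz
      refine hk.differentiableAt.congr_of_eventuallyEq ?_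
      filter_upwards [hgk] with w hw
      split_ifs with h
      · rw [h]
      · rw [hw, smul_eq_mul, mul_div_cancel_left₀ _ (pow_ne_zero _ (sub_ne_zero.2 h))]
    · have : DifferentiableAt ℂ (fun z => g z / (z - u) ^ n) z :=
        (hg z).div (by fun_prop) (pow_ne_zero _ (sub_ne_zero.2 hz))
      refine this.congr_of_eventuallyEq ?_
      filter_upwards [isOpen_ne.mem_nhds hz] with w hw
      simp [show w ≠ u from hw]
  · by_cases hz : z = u
    · simp only [hz, if_true]; exact hgu
    · simp only [hz, if_false]
      rw [mul_div_cancel₀ _ (pow_ne_zero _ (sub_ne_zero.2 hz))]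

/-- Zeros are removed one at a time: the factors already split off do not vanish at the next point,
so the cofactor has the same order there as g. The normalization 1 - z/u keeps the value at 0. -/
theorem exists_eq_prod_one_sub_div_pow_mul {g : ℂ → ℂ} (hg : Differentiable ℂ g)
    (hord : ∀ u, analyticOrderAt g u ≠ ⊤) (S : Finset ℂ) (hS : (0 : ℂ) ∉ S) :
    ∃ h : ℂ → ℂ, Differentiable ℂ h ∧ (∀ u ∈ S, h u ≠ 0) ∧
      ∀ z, g z = (∏ u ∈ S, (1 - z / u) ^ analyticOrderNatAt g u) * h z := by
  classical
  induction S using Finset.induction_on with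
  | empty => exact ⟨g, hg, by simp, by simp⟩
  | insert u S huS ih =>
    rw [Finset.mem_insert, not_or] at hS
    obtain ⟨h, hh, hh0, hgh⟩ := ih hS.2
    set p : ℂ → ℂ := fun z => ∏ v ∈ S, (1 - z / v) ^ analyticOrderNatAt g v
    have hp : Differentiable ℂ p := by fun_prop
    have hpu : p u ≠ 0 := Finset.prod_ne_zero_iff.2 fun v hv => pow_ne_zero _ <| by
      have hv0 : v ≠ 0 := fun h0 => hS.2 (h0 ▸ hv)
      rw [sub_ne_zero, ne_comm, Ne, div_eq_one_iff_eq hv0]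
      rintro rfl
      exact huS hv
    have hgph : g = p * h := funext hgh
    have hmul : analyticOrderAt g u = analyticOrderAt h u := by
      rw [hgph, analyticOrderAt_mul (hp.analyticAt u) (hh.analyticAt u),
        (hp.analyticAt u).analyticOrderAt_eq_zero.2 hpu, zero_add]
    have hnat : analyticOrderNatAt h u = analyticOrderNatAt g u := by
      rw [analyticOrderNatAt, analyticOrderNatAt, hmul]
    obtain ⟨k, hk, hku, hhk⟩ := exists_eq_sub_pow_mul hh (hmul ▸ hord u)
    have hu0 : u ≠ 0 := fun h0 => hS.1 h0.symm
    refine ⟨fun z => (-u) ^ analyticOrderNatAt g u * k z, by fun_prop, ?_, fun z => ?_⟩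
    · intro v hv
      refine mul_ne_zero (pow_ne_zero _ (neg_ne_zero.2 hu0)) ?_
      rcases Finset.mem_insert.1 hv with rfl | hv
      · exact hku
      · intro hkv
        exact hh0 v hv (by rw [hhk, hkv, mul_zero])
    · rw [Finset.prod_insert huS, hgh z, hhk z, hnat]
      have : (z - u) ^ analyticOrderNatAt g u =
          (1 - z / u) ^ analyticOrderNatAt g u * (-u) ^ analyticOrderNatAt g u := by
        rw [← mul_pow]
        congr 1
        field_simp
        ring
      rw [this]
      ring

/-- A zero-free holomorphic function on a disc has a holomorphic logarithm. -/
theorem exists_exp_eq_of_differentiableOn_ball {k : ℂ → ℂ} {R : ℝ} (hR : 0 < R)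
    (hk : DifferentiableOn ℂ k (Metric.ball 0 R)) (hk0 : k 0 = 1)
    (hne : ∀ z ∈ Metric.ball 0 R, k z ≠ 0) :
    ∃ l : ℂ → ℂ, DifferentiableOn ℂ l (Metric.ball 0 R) ∧ l 0 = 0 ∧
      ∀ z ∈ Metric.ball 0 R, k z = Complex.exp (l z) := by
  have hd : DifferentiableOn ℂ (fun z => deriv k z / k z) (Metric.ball 0 R) :=
    (hk.deriv Metric.isOpen_ball).div hk hne
  obtain ⟨l, hl0, hl⟩ := hd.isExactOn_ball.with_val_at 0 0
  refine ⟨l, fun z hz => (hl z hz).differentiableAt.differentiableWithinAt, hl0, ?_⟩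
  have hderiv : ∀ z ∈ Metric.ball (0 : ℂ) R,
      HasDerivAt (fun z => k z * Complex.exp (-l z)) 0 z := by
    intro z hz
    have h1 := (hk.differentiableAt (Metric.isOpen_ball.mem_nhds hz)).hasDerivAt
    refine (h1.mul (hl z hz).neg.cexp).congr_deriv ?_
    have := hne z hz
    simp only [Pi.neg_apply]
    field_simp
    ring
  intro z hz
  have hconst := Metric.isOpen_ball.is_const_of_deriv_eq_zero
    (convex_ball (0 : ℂ) R).isPreconnected
    (fun w hw => (hderiv w hw).differentiableAt.differentiableWithinAt)
    (fun w hw => (hderiv w hw).deriv) hz (Metric.mem_ball_self hR)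
  simp only [hk0, hl0, neg_zero, Complex.exp_zero, mul_one, Complex.exp_neg] at hconst
  field_simp at hconst
  exact hconst

/-- The finitely many zeros in a disc, divided out with Blaschke factors, leave a function
which is close to `1` near the centre. -/
theorem exists_norm_log_le_of_zeros_divided_out {g : ℂ → ℂ} (hg : Differentiable ℂ g)
    (h0 : g 0 = 1) (hord : ∀ u, analyticOrderAt g u ≠ ⊤) {R M : ℝ} (hR : 0 < R) (hM : 0 < M)
    (hgM : ∀ z, ‖z‖ = R → ‖g z‖ ≤ Real.exp M) (S : Finset ℂ)
    (hS : ∀ u, u ∈ S ↔ ‖u‖ < R ∧ g u = 0) :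
    ∃ l : ℂ → ℂ, ∀ z, ‖z‖ < R → ‖l z‖ ≤ 2 * M * ‖z‖ / (R - ‖z‖) ∧
      g z * ∏ u ∈ S, (1 - conj u * z / R ^ 2) ^ analyticOrderNatAt g u =
        Complex.exp (l z) * ∏ u ∈ S, (1 - z / u) ^ analyticOrderNatAt g u := by
  have hS0 : (0 : ℂ) ∉ S := fun h => by simpa [h0] using ((hS 0).1 h).2
  obtain ⟨h, hh, hhS, hgh⟩ := exists_eq_prod_one_sub_div_pow_mul hg hord S hS0
  set b : ℂ → ℂ := fun z => ∏ u ∈ S, (1 - conj u * z / R ^ 2) ^ analyticOrderNatAt g u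
  set k : ℂ → ℂ := fun z => h z * b z
  have hk : Differentiable ℂ k := by fun_prop
  have hh0 : h 0 = 1 := by simpa [h0] using (hgh 0).symm
  have hk0 : k 0 = 1 := by simp [k, b, hh0]
  have hRC : (R : ℂ) ≠ 0 := by exact_mod_cast hR.ne'
  have hne : ∀ z ∈ Metric.ball (0 : ℂ) R, k z ≠ 0 := by
    intro z hz
    rw [mem_ball_zero_iff] at hz
    refine mul_ne_zero (fun hhz => ?_) (Finset.prod_ne_zero_iff.2 fun u hu => pow_ne_zero _ ?_)
    · exact hhS z ((hS z).2 ⟨hz, by rw [hgh, hhz, mul_zero]⟩) hhz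
    · intro heq
      have huR := ((hS u).1 hu).1
      have h1 : conj u * z = R ^ 2 := by
        rw [sub_eq_zero, eq_div_iff (pow_ne_zero 2 hRC), one_mul] at heq
        exact heq.symm
      have h2 : ‖u‖ * ‖z‖ = R ^ 2 := by
        have := congrArg norm h1
        simpa [abs_of_pos hR] using this
      nlinarith [norm_nonneg u, norm_nonneg z]
  have hsphere : ∀ z, ‖z‖ = R → ‖k z‖ ≤ Real.exp M := by
    intro z hz
    refine le_trans ?_ (hgM z hz)
    rw [hgh z, norm_mul, norm_mul, mul_comm]
    refine mul_le_mul_of_nonneg_right ?_ (norm_nonneg _)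
    simp only [b, norm_prod, norm_pow]
    refine Finset.prod_le_prod (fun _ _ => by positivity) fun u hu => ?_
    refine pow_le_pow_left₀ (norm_nonneg _) ?_ _
    obtain ⟨huR, hgu⟩ := (hS u).1 hu
    have hu0 : u ≠ 0 := fun h => hS0 (h ▸ hu)
    -- On |z| = R we have R² = z z̄, so this factor has modulus |z - u|/R ≤ |z - u|/|u| = |1 - z/u|.
    -- Trading one factor for the other does not increase the modulus on the circle.
    have e1 : 1 - conj u * z / R ^ 2 = z * conj (z - u) / R ^ 2 := by
      have : (R : ℂ) ^ 2 = z * conj z := by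
        rw [Complex.mul_conj, Complex.normSq_eq_norm_sq, hz]; norm_cast
      rw [map_sub, mul_sub, ← this]
      field_simp
    have e2 : 1 - z / u = -(z - u) / u := by field_simp; ring
    rw [e1, e2, norm_div, norm_div, norm_mul, Complex.norm_conj, norm_neg, hz, norm_pow,
      Complex.norm_real, Real.norm_of_nonneg hR.le, sq, mul_div_mul_left _ _ hR.ne']
    have := norm_pos_iff.2 hu0
    gcongr
  obtain ⟨l, hl, hl0, hkl⟩ := exists_exp_eq_of_differentiableOn_ball hR hk.differentiableOn hk0 hne
  have hball : ∀ z ∈ Metric.ball (0 : ℂ) R, ‖k z‖ ≤ Real.exp M := fun z hz =>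
    Complex.norm_le_of_forall_mem_frontier_norm_le Metric.isBounded_ball hk.diffContOnCl
      (fun w hw => hsphere w (by simpa [frontier_ball _ hR.ne'] using hw)) (subset_closure hz)
  refine ⟨l, fun z hz => ⟨?_, ?_⟩⟩
  -- Re l = log|k| ≤ M by the maximum principle, and l(0) = 0.
  · refine Complex.borelCaratheodory_zero hM hl (fun w hw => ?_) hR (by simpa using hz) hl0
    have := hball w hw
    rw [hkl w hw, Complex.norm_exp, Real.exp_le_exp] at this
    exact this
  · rw [← hkl z (by simpa using hz), hgh z]
    simp only [k, b]
    ring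

/-- Summable positive families are countable, so they embed in ℕ; the unused indices get 0, that is,
the factor 1. -/
theorem Summable.exists_nat_extension {ι : Type*} {x : ι → ℝ} (hx : ∀ i, 0 < x i)
    (hs : Summable x) :
    ∃ y : ℕ → ℝ, (∀ k, 0 ≤ y k) ∧ Summable y ∧
      ∀ z t : ℂ, HasProd (fun i => 1 + x i * z) t → HasProd (fun k => 1 + y k * z) t := by
  have hc : Countable ι := by
    have h := hs.countable_support
    rwa [show Function.support x = Set.univ from
      Set.eq_univ_of_forall fun i => (hx i).ne', Set.countable_univ_iff] at h
  obtain ⟨j, hj⟩ := hc.exists_injective_nat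
  have hcomp : ∀ i, Function.extend j x 0 (j i) = x i := fun i => hj.extend_apply _ _ _
  have hout : ∀ k ∉ Set.range j, Function.extend j x 0 k = 0 := fun k hk =>
    Function.extend_apply' _ _ _ hk
  refine ⟨Function.extend j x 0, fun k => ?_, ?_, fun z t ht => ?_⟩
  · by_cases hk : k ∈ Set.range j
    · obtain ⟨i, rfl⟩ := hk
      rw [hcomp]
      exact (hx i).le
    · rw [hout k hk]
  · refine (hj.summable_iff hout).1 (hs.congr fun i => ?_)
    simp [hcomp]
  · refine (hj.hasProd_iff fun k hk => ?_).1 ?_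
    · simp [hout k hk]
    · simpa [Function.comp_def, hcomp] using ht

theorem one_add_sum_le_prod_one_add {ι : Type*} {x : ι → ℝ} (hx : ∀ i, 0 ≤ x i)
    (s : Finset ι) : 1 + ∑ i ∈ s, x i ≤ ∏ i ∈ s, (1 + x i) := by
  classical
  induction s using Finset.induction_on with
  | empty => simp
  | insert i s hi ih =>
    rw [Finset.sum_insert hi, Finset.prod_insert hi]
    have := Finset.sum_nonneg fun j (_ : j ∈ s) => hx j
    nlinarith [hx i, mul_nonneg (hx i) this]

theorem exists_sphere_bound_isLittleO {g : ℂ → ℂ} (hg : Continuous g)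
    (hgrow : ∀ ε > 0, ∃ C : ℝ, ∀ z, ‖g z‖ ≤ C * Real.exp (ε * ‖z‖)) :
    ∃ M : ℝ → ℝ, (∀ R, 0 ≤ R → 0 < M R ∧ ∀ w, ‖w‖ = R → ‖g w‖ ≤ Real.exp (M R)) ∧
      Tendsto (fun R => M R / R) atTop (𝓝 0) := by
  have hmax : ∀ R : ℝ, ∃ w : ℂ, 0 ≤ R → ‖w‖ = R ∧ ∀ v : ℂ, ‖v‖ = R → ‖g v‖ ≤ ‖g w‖ := by
    intro R
    by_cases hR : 0 ≤ R
    · obtain ⟨w, hw, hwm⟩ := (isCompact_sphere (0 : ℂ) R).exists_isMaxOn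
        (NormedSpace.sphere_nonempty.2 hR) hg.norm.continuousOn
      exact ⟨w, fun _ => ⟨by simpa using hw, fun v hv => hwm (by simpa using hv)⟩⟩
    · exact ⟨0, fun h => absurd h hR⟩
  choose w hw using hmax
  -- The outer 1 makes M positive, as Borel–Carathéodory needs; the inner 1 keeps the logarithm
  -- nonnegative.
  refine ⟨fun R => 1 + Real.log (1 + ‖g (w R)‖), fun R hR => ⟨?_, fun v hv => ?_⟩, ?_⟩
  · have := Real.log_nonneg (by linarith [norm_nonneg (g (w R))] : 1 ≤ 1 + ‖g (w R)‖)
    linarith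
  · have h1 : 0 < 1 + ‖g (w R)‖ := by positivity
    calc ‖g v‖ ≤ 1 + ‖g (w R)‖ := by linarith [(hw R hR).2 v hv]
      _ = Real.exp (Real.log (1 + ‖g (w R)‖)) := (Real.exp_log h1).symm
      _ ≤ _ := Real.exp_le_exp.2 (by linarith)
  · rw [tendsto_order]
    constructor
    · intro c hc
      filter_upwards [eventually_gt_atTop 0] with R hR
      refine hc.trans_le (div_nonneg ?_ hR.le)
      have := Real.log_nonneg (by linarith [norm_nonneg (g (w R))] : 1 ≤ 1 + ‖g (w R)‖)
      linarith
    · intro c hc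
      obtain ⟨C, hC⟩ := hgrow (c / 2) (by positivity)
      set D := 1 + Real.log (1 + |C|)
      filter_upwards [eventually_gt_atTop 0, eventually_gt_atTop (2 * D / c)] with R hR hRD
      rw [div_lt_iff₀ hR]
      rw [div_lt_iff₀ hc] at hRD
      have h1 : 1 + ‖g (w R)‖ ≤ (1 + |C|) * Real.exp (c / 2 * R) := by
        have := hC (w R)
        rw [(hw R hR.le).1] at this
        have h2 : 1 ≤ Real.exp (c / 2 * R) := Real.one_le_exp (by positivity)
        nlinarith [le_abs_self C]
      have h2 := Real.log_le_log (by positivity) h1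
      rw [Real.log_mul (by positivity) (Real.exp_pos _).ne', Real.log_exp] at h2
      linarith

/-- **Hadamard factorization** for entire functions of minimal exponential type whose zeros are
negative. -/
theorem exists_hasProd_of_zeros_neg {g : ℂ → ℂ} (hg : Differentiable ℂ g) (h0 : g 0 = 1)
    (hz : ∀ z, g z = 0 → ∃ x : ℝ, x < 0 ∧ z = x)
    (hgrow : ∀ ε > 0, ∃ C : ℝ, ∀ z, ‖g z‖ ≤ C * Real.exp (ε * ‖z‖)) :
    ∃ x : ℕ → ℝ, (∀ k, 0 ≤ x k) ∧ Summable x ∧ ∀ z : ℂ, HasProd (fun k => 1 + x k * z) (g z) := by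
  classical
  have han : AnalyticOnNhd ℂ g Set.univ := fun z _ => hg.analyticAt z
  have hord : ∀ u, analyticOrderAt g u ≠ ⊤ := by
    intro u hu
    rw [analyticOrderAt_eq_top] at hu
    have := han.eqOn_zero_of_preconnected_of_eventuallyEq_zero isPreconnected_univ
      (Set.mem_univ u) hu (Set.mem_univ 0)
    simp [h0] at this
  set n := analyticOrderNatAt g
  have hfin : ∀ R : ℝ, {u : ℂ | ‖u‖ < R ∧ g u = 0}.Finite := by
    intro R
    have hcod := han.preimage_zero_mem_codiscrete (x := 0) (by simp [h0])
    refine ((isCompact_closedBall (0 : ℂ) R).finite_sdiff_of_mem_codiscreteWithin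
      (codiscreteWithin_mono (Set.subset_univ _) hcod)).subset fun u hu => ?_
    exact ⟨by simpa using hu.1.le, by simpa using hu.2⟩
  set S : ℝ → Finset ℂ := fun R => (hfin R).toFinset
  have hS : ∀ R u, u ∈ S R ↔ ‖u‖ < R ∧ g u = 0 := fun R u => by simp [S]
  -- Indices for the zeros -aᵢ, repeated according to multiplicity.
  set ι := Σ a : {a : ℂ // g a = 0}, Fin (n a)
  set a : ι → ℝ := fun i => -(i.1 : ℂ).re
  have ha : ∀ i : ι, 0 < a i ∧ ((i.1 : ℂ)) = -(a i : ℂ) := by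
    rintro ⟨⟨u, hu⟩, j⟩
    obtain ⟨y, hy, rfl⟩ := hz u hu
    simp [a, hy]
  set T : ℝ → Finset ι := fun R => (Finset.subtype (fun a => g a = 0) (S R)).sigma
    fun a => (Finset.univ : Finset (Fin (n a)))
  have hT : ∀ R i, i ∈ T R ↔ a i < R := by
    intro R i
    have h1 : ‖(i.1 : ℂ)‖ = a i := by
      rw [(ha i).2, norm_neg, Complex.norm_real, Real.norm_of_nonneg (ha i).1.le]
    simp only [T]
    rw [Finset.mem_sigma, Finset.mem_subtype, hS, h1]
    simp [i.1.2]
  have hprodT : ∀ (R : ℝ) (φ : ℂ → ℂ),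
      ∏ u ∈ S R, φ u ^ n u = ∏ i ∈ T R, φ (-(a i : ℂ)) := by
    intro R φ
    have : ∀ i ∈ T R, φ (-(a i : ℂ)) = φ (i.1 : ℂ) := fun i _ => by rw [(ha i).2]
    rw [Finset.prod_congr rfl this, Finset.prod_sigma]
    simp only [Finset.prod_const, Finset.card_univ, Fintype.card_fin]
    rw [Finset.prod_subtype_of_mem (fun u => φ u ^ n u)]
    intro u hu
    exact ((hS R u).1 hu).2
  have hTtop : Tendsto T atTop atTop := by
    refine tendsto_atTop_finset_of_monotone (fun R R' h i hi => ?_) fun i => ⟨a i + 1, ?_⟩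
    · rw [hT] at hi ⊢
      linarith
    · rw [hT]
      linarith
  obtain ⟨M, hM, hMlim⟩ := exists_sphere_bound_isLittleO hg.continuous hgrow
  -- κ(R) = exp l with |l| ≤ 2M(R)|z|/(R - |z|), and M(R) = o(R) forces l → 0.
  have hkey : ∀ z : ℂ, ∃ κ : ℝ → ℂ, Tendsto κ atTop (𝓝 1) ∧ ∀ᶠ R : ℝ in atTop,
      g z * ∏ i ∈ T R, (1 + (a i / R ^ 2 : ℝ) * z) =
        κ R * ∏ i ∈ T R, (1 + ((a i)⁻¹ : ℝ) * z) := by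
    intro z
    have hlog : ∀ R : ℝ, ∃ l : ℂ, ‖z‖ < R → ‖l‖ ≤ 2 * M R * ‖z‖ / (R - ‖z‖) ∧
        g z * ∏ i ∈ T R, (1 + (a i / R ^ 2 : ℝ) * z) =
          Complex.exp l * ∏ i ∈ T R, (1 + ((a i)⁻¹ : ℝ) * z) := by
      intro R
      by_cases hR : 0 < R
      · obtain ⟨l, hl⟩ := exists_norm_log_le_of_zeros_divided_out hg h0 hord hR (hM R hR.le).1
          (hM R hR.le).2 (S R) (hS R)
        refine ⟨l z, fun hzR => ⟨(hl z hzR).1, ?_⟩⟩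
        have h := (hl z hzR).2
        rw [hprodT R fun u => 1 - conj u * z / R ^ 2, hprodT R fun u => 1 - z / u] at h
        convert h using 3 with i hi
        · simp; ring
        · push_cast
          rw [div_neg, sub_neg_eq_add, div_eq_inv_mul]
      · exact ⟨0, fun h => absurd ((norm_nonneg z).trans_lt h) hR⟩
    choose l hl using hlog
    refine ⟨fun R => Complex.exp (l R), ?_, ?_⟩
    · have hl0 : Tendsto l atTop (𝓝 0) := by
        have hlim : Tendsto (fun R => 2 * (M R / R) * ‖z‖ / (1 - ‖z‖ / R)) atTop
            (𝓝 (2 * 0 * ‖z‖ / (1 - 0))) :=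
          ((hMlim.const_mul 2).mul_const _).div
            (tendsto_const_nhds.sub (tendsto_const_nhds.div_atTop tendsto_id)) (by norm_num)
        simp only [mul_zero, zero_mul, zero_div] at hlim
        refine squeeze_zero_norm' ?_ hlim
        filter_upwards [eventually_gt_atTop ‖z‖] with R hR
        have hR0 := (norm_nonneg z).trans_lt hR
        refine (hl R hR).1.trans_eq ?_
        have : R - ‖z‖ ≠ 0 := (sub_pos.2 hR).ne'
        field_simp
      simpa using hl0.cexp
    · filter_upwards [eventually_gt_atTop ‖z‖] with R hR using (hl R hR).2
  have hle : ∀ R : ℝ, 0 < R → ∀ i ∈ T R, a i / R ^ 2 ≤ (a i)⁻¹ := by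
    intro R hR i hi
    rw [hT] at hi
    have := (ha i).1
    rw [div_le_iff₀ (by positivity), inv_mul_eq_div, le_div_iff₀ this]
    nlinarith
  -- At z = 1, the factors outside s on the left are dominated by those on the right (`hle`) and can
  -- be cancelled. Letting R → ∞ leaves ∏_{i ∈ s}(1 + 1/aᵢ) ≤ |g(1)|, which bounds every partial
  -- sum.
  have hsum : Summable fun i => (a i)⁻¹ := by
    refine summable_of_sum_le (fun i => (inv_pos.2 (ha i).1).le) (c := ‖g 1‖) fun s => ?_
    refine ((le_add_of_nonneg_left zero_le_one).trans
      (one_add_sum_le_prod_one_add (fun i => (inv_pos.2 (ha i).1).le) s)).trans ?_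
    obtain ⟨κ, hκ, hrel⟩ := hkey 1
    have hlim1 : Tendsto (fun R => ‖κ R‖ * ∏ i ∈ s, (1 + (a i)⁻¹)) atTop
        (𝓝 (‖(1 : ℂ)‖ * ∏ i ∈ s, (1 + (a i)⁻¹))) := hκ.norm.mul_const _
    have hlim2 : Tendsto (fun R : ℝ => ‖g 1‖ * ∏ i ∈ s, (1 + a i / R ^ 2)) atTop
        (𝓝 (‖g 1‖ * ∏ i ∈ s, (1 + 0))) :=
      (tendsto_finsetProd _ fun i _ => tendsto_const_nhds.add
        (tendsto_const_nhds.div_atTop (tendsto_pow_atTop two_ne_zero))).const_mul _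
    simp only [norm_one, one_mul, add_zero, Finset.prod_const_one, mul_one] at hlim1 hlim2
    refine le_of_tendsto_of_tendsto hlim1 hlim2 ?_
    filter_upwards [hrel, hTtop.eventually_ge_atTop s, eventually_gt_atTop 0] with R h hsR hR
    have h1 := congrArg norm h
    simp only [mul_one, norm_mul, norm_prod] at h1
    have hn : ∀ y : ℝ, 0 ≤ y → ‖(1 : ℂ) + (y : ℂ)‖ = 1 + y := fun y hy => by
      rw [← Complex.ofReal_one, ← Complex.ofReal_add, Complex.norm_real,
        Real.norm_of_nonneg (by positivity)]
    rw [Finset.prod_congr rfl fun i _ => hn _ (div_nonneg (ha i).1.le (sq_nonneg R)),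
      Finset.prod_congr rfl fun i _ => hn _ (inv_pos.2 (ha i).1).le,
      ← Finset.prod_sdiff hsR, ← Finset.prod_sdiff hsR] at h1
    have hpos : 0 < ∏ i ∈ T R \ s, (1 + (a i)⁻¹) := Finset.prod_pos fun i _ => by
      have := inv_pos.2 (ha i).1
      positivity
    have hcmp : ∏ i ∈ T R \ s, (1 + a i / R ^ 2) ≤ ∏ i ∈ T R \ s, (1 + (a i)⁻¹) :=
      Finset.prod_le_prod (fun i _ => by have := (ha i).1; positivity)
        fun i hi => by linarith [hle R hR i (Finset.sdiff_subset hi)]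
    have hs0 : 0 ≤ ∏ i ∈ s, (1 + a i / R ^ 2) :=
      Finset.prod_nonneg fun i _ => by have := (ha i).1; positivity
    refine le_of_mul_le_mul_left ?_ hpos
    calc _ = ‖κ R‖ * ((∏ i ∈ T R \ s, (1 + (a i)⁻¹)) * ∏ i ∈ s, (1 + (a i)⁻¹)) := by ring
      _ = (∏ i ∈ T R \ s, (1 + a i / R ^ 2)) * (‖g 1‖ * ∏ i ∈ s, (1 + a i / R ^ 2)) := by
        rw [← h1]; ring
      _ ≤ _ := mul_le_mul_of_nonneg_right hcmp (by positivity)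
  obtain ⟨x, hx, hxs, hxp⟩ := hsum.exists_nat_extension fun i => inv_pos.2 (ha i).1
  refine ⟨x, hx, hxs, fun z => hxp z _ ?_⟩
  have hsumz : Summable fun i => ‖(((a i)⁻¹ : ℝ) : ℂ) * z‖ := by
    refine (hsum.mul_right ‖z‖).congr fun i => ?_
    rw [norm_mul, Complex.norm_real, Real.norm_of_nonneg (inv_pos.2 (ha i).1).le]
  have hmul := multipliable_one_add_of_summable hsumz
  obtain ⟨κ, hκ, hrel⟩ := hkey z
  -- Dominated convergence: each coefficient aᵢ/R² tends to 0, and 1/aᵢ is a summable majorant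
  -- uniform in R.
  have hleft : Tendsto (fun R => ∏ i ∈ T R, (1 + ((a i / R ^ 2 : ℝ) : ℂ) * z)) atTop (𝓝 1) := by
    have h := tendsto_tprod_one_add_of_dominated_convergence (𝓕 := atTop)
      (f := fun (R : ℝ) i => if i ∈ T R then ((a i / R ^ 2 : ℝ) : ℂ) * z else 0)
      (g := fun _ : ι => 0) hsumz (fun i => ?_) ?_
    · simp only [add_zero, tprod_one] at h
      refine h.congr fun R => ?_
      rw [tprod_eq_prod (s := T R) fun i hi => by simp [hi]]
      exact Finset.prod_congr rfl fun i hi => by simp [hi]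
    · have h1 : Tendsto (fun R : ℝ => a i / R ^ 2 * ‖z‖) atTop (𝓝 (0 * ‖z‖)) :=
        (tendsto_const_nhds.div_atTop (tendsto_pow_atTop two_ne_zero)).mul_const _
      rw [zero_mul] at h1
      refine squeeze_zero_norm (fun R => ?_) h1
      have := (ha i).1
      split_ifs
      · rw [norm_mul, Complex.norm_real, Real.norm_of_nonneg (by positivity)]
      · rw [norm_zero]; positivity
    · filter_upwards [eventually_gt_atTop 0] with R hR i
      have := (ha i).1
      split_ifs with hi
      · rw [norm_mul, norm_mul, Complex.norm_real, Complex.norm_real,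
          Real.norm_of_nonneg (by positivity), Real.norm_of_nonneg (by positivity)]
        exact mul_le_mul_of_nonneg_right (hle R hR i hi) (norm_nonneg _)
      · rw [norm_zero]; positivity
  have hright := hκ.mul (hmul.hasProd.comp hTtop)
  have heq := tendsto_nhds_unique_of_eventuallyEq (hleft.const_mul (g z)) hright hrel
  rw [mul_one, one_mul] at heq
  rw [heq]
  exact hmul.hasProd

/-! ### Canonical products: modulus, argument, logarithmic derivative -/

/-- The canonical product `∏ₖ (1 + xₖ w)`. -/
noncomputable def canonicalProd (x : ℕ → ℝ) (w : ℂ) : ℂ := ∏' k, (1 + (x k : ℂ) * w)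

/-- The argument `∑ₖ arg (1 + xₖ w)` of the canonical product. -/
noncomputable def canonicalArg (x : ℕ → ℝ) (w : ℂ) : ℝ := ∑' k, (1 + (x k : ℂ) * w).arg

theorem abs_arg_one_add_le (u : ℂ) : |(1 + u).arg| ≤ 2 * Real.pi * ‖u‖ := by
  rcases le_total ‖u‖ (1 / 2) with hu | hu
  · have h1 := Complex.norm_log_one_add_half_le_self hu
    have h2 := Complex.abs_im_le_norm (Complex.log (1 + u))
    rw [Complex.log_im] at h2
    nlinarith [Real.pi_gt_three, norm_nonneg u]
  · have := Complex.abs_arg_le_pi (1 + u)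
    nlinarith [Real.pi_pos]

/-- The principal argument jumps only across the negative axis, and its value π there is the limit
from above. -/
theorem continuousWithinAt_arg_of_ne_zero {u : ℂ} (hu : u ≠ 0) :
    ContinuousWithinAt Complex.arg {z | 0 ≤ z.im} u := by
  by_cases h : u ∈ Complex.slitPlane
  · exact (Complex.continuousAt_arg h).continuousWithinAt
  · rw [Complex.mem_slitPlane_iff, not_or, not_lt, not_not] at h
    refine Complex.continuousWithinAt_arg_of_re_neg_of_im_zero (lt_of_le_of_ne h.1 fun h0 => ?_) h.2
    exact hu (Complex.ext h0 h.2)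

theorem re_sq_add_im_sq_eq_of_norm_eq {w w' : ℂ} (hn : ‖w‖ = ‖w'‖) :
    w.re ^ 2 + w.im ^ 2 = w'.re ^ 2 + w'.im ^ 2 := by
  have h := congrArg (· ^ 2) hn
  simp only [Complex.sq_norm, Complex.normSq_apply] at h
  linarith

theorem summable_norm_mul_of_nonneg {x : ℕ → ℝ} (hx : ∀ k, 0 ≤ x k) (hs : Summable x)
    (w : ℂ) : Summable fun k => ‖(x k : ℂ) * w‖ := by
  refine (hs.mul_right ‖w‖).congr fun k => ?_
  rw [norm_mul, Complex.norm_real, Real.norm_of_nonneg (hx k)]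

theorem hasProd_canonicalProd {x : ℕ → ℝ} (hx : ∀ k, 0 ≤ x k) (hs : Summable x)
    (w : ℂ) :
    HasProd (fun k => 1 + (x k : ℂ) * w) (canonicalProd x w) :=
  (multipliable_one_add_of_summable (summable_norm_mul_of_nonneg hx hs w)).hasProd

theorem hasProdLocallyUniformlyOn_canonicalProd {x : ℕ → ℝ} (hx : ∀ k, 0 ≤ x k) (hs : Summable x)
    (R : ℝ) :
    HasProdLocallyUniformlyOn (fun k w => 1 + (x k : ℂ) * w) (canonicalProd x)
      (Metric.ball 0 R) := by
  refine Summable.hasProdLocallyUniformlyOn_one_add Metric.isOpen_ball (hs.mul_right R)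
    (Eventually.of_forall fun k w hw => ?_) fun k => by fun_prop
  rw [norm_mul, Complex.norm_real, Real.norm_of_nonneg (hx k)]
  exact mul_le_mul_of_nonneg_left (mem_ball_zero_iff.1 hw).le (hx k)

theorem differentiable_canonicalProd {x : ℕ → ℝ} (hx : ∀ k, 0 ≤ x k) (hs : Summable x)
    : Differentiable ℂ (canonicalProd x) := by
  intro w
  have h := hasProdLocallyUniformlyOn_canonicalProd hx hs (‖w‖ + 1)
  refine (TendstoLocallyUniformlyOn.differentiableOn h (Eventually.of_forall fun s => ?_)
    Metric.isOpen_ball).differentiableAt (Metric.isOpen_ball.mem_nhds (by simp))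
  fun_prop

theorem canonicalProd_conj {x : ℕ → ℝ} (hx : ∀ k, 0 ≤ x k) (hs : Summable x)
    (w : ℂ) : canonicalProd x (conj w) = conj (canonicalProd x w) := by
  have h := (hasProd_canonicalProd hx hs w).map (starRingEnd ℂ) Complex.continuous_conj
  refine (hasProd_canonicalProd hx hs (conj w)).unique ?_
  simpa [Function.comp_def] using h

theorem canonicalProd_ofReal_im {x : ℕ → ℝ} (hx : ∀ k, 0 ≤ x k) (hs : Summable x)
    (r : ℝ) : (canonicalProd x r).im = 0 := by
  have h := canonicalProd_conj hx hs r
  rw [Complex.conj_ofReal] at h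
  exact Complex.conj_eq_iff_im.1 h.symm

theorem canonicalProd_ne_zero {x : ℕ → ℝ} (hx : ∀ k, 0 ≤ x k) (hs : Summable x)
    {w : ℂ} (hw : w.im ≠ 0 ∨ 0 ≤ w.re) : canonicalProd x w ≠ 0 := by
  refine tprod_one_add_ne_zero_of_summable (fun k h => ?_) (summable_norm_mul_of_nonneg hx hs w)
  have him := congrArg Complex.im h
  have hre := congrArg Complex.re h
  simp at him hre
  rcases hw with hw | hw
  · simp [him.resolve_right hw] at hre
  · nlinarith [hx k, mul_nonneg (hx k) hw]

theorem one_add_mul_ne_zero_of_canonicalProd_ne_zero {x : ℕ → ℝ}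
    {w : ℂ} (hw : canonicalProd x w ≠ 0)
    (k : ℕ) : 1 + (x k : ℂ) * w ≠ 0 := fun h =>
  hw (tprod_of_exists_eq_zero ⟨k, h⟩)

theorem canonicalProd_eq_mul_update {x : ℕ → ℝ} (hx : ∀ k, 0 ≤ x k) (hs : Summable x)
    (w : ℂ) (j : ℕ) :
    canonicalProd x w = (1 + x j * w) * canonicalProd (Function.update x j 0) w := by
  have hx' : ∀ k, 0 ≤ Function.update x j 0 k := fun k => by
    rcases eq_or_ne k j with rfl | h
    · simp
    · simpa [h] using hx k
  have hs' : Summable (Function.update x j 0) := hs.update j 0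
  have h1 : HasProd (fun k => if k = j then 1 + (x j : ℂ) * w else 1) (1 + x j * w) :=
    hasProd_ite_eq j _
  refine (hasProd_canonicalProd hx hs w).unique ?_
  convert h1.mul (hasProd_canonicalProd hx' hs' w) using 2 with k
  rcases eq_or_ne k j with rfl | h
  · simp
  · simp [h]

/-- |1 + xw|² = 1 + 2x Re w + x²|w|², so on a circle only Re w matters. -/
theorem norm_one_add_mul_le {x : ℕ → ℝ} (hx : ∀ k, 0 ≤ x k)
    {w w' : ℂ} (hn : ‖w‖ = ‖w'‖) (hre : w.re ≤ w'.re) (k : ℕ) :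
    ‖1 + (x k : ℂ) * w‖ ≤ ‖1 + (x k : ℂ) * w'‖ := by
  have h := re_sq_add_im_sq_eq_of_norm_eq hn
  rw [← sq_le_sq₀ (norm_nonneg _) (norm_nonneg _), Complex.sq_norm, Complex.sq_norm,
    Complex.normSq_apply, Complex.normSq_apply]
  have e : x k ^ 2 * _ = x k ^ 2 * _ := congrArg (x k ^ 2 * ·) h
  simp
  nlinarith [mul_le_mul_of_nonneg_left hre (hx k)]

theorem norm_canonicalProd_le {x : ℕ → ℝ} (hx : ∀ k, 0 ≤ x k) (hs : Summable x)
    {w w' : ℂ} (hn : ‖w‖ = ‖w'‖) (hre : w.re ≤ w'.re) :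
    ‖canonicalProd x w‖ ≤ ‖canonicalProd x w'‖ :=
  le_of_tendsto_of_tendsto' (hasProd_canonicalProd hx hs w).norm
    (hasProd_canonicalProd hx hs w').norm fun _ =>
      Finset.prod_le_prod (fun _ _ => norm_nonneg _) fun k _ => norm_one_add_mul_le hx hn hre k

theorem norm_canonicalProd_lt {x : ℕ → ℝ} (hx : ∀ k, 0 ≤ x k) (hs : Summable x)
    {w w' : ℂ} (hn : ‖w‖ = ‖w'‖) (hre : w.re < w'.re)
    (hpos : ∃ j, 0 < x j) : ‖canonicalProd x w‖ < ‖canonicalProd x w'‖ := by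
  obtain ⟨j, hj⟩ := hpos
  have hx' : ∀ k, 0 ≤ Function.update x j 0 k := fun k => by
    rcases eq_or_ne k j with rfl | h
    · simp
    · simpa [h] using hx k
  have hs' : Summable (Function.update x j 0) := hs.update j 0
  have h := re_sq_add_im_sq_eq_of_norm_eq hn
  -- A negative w' would be the leftmost point of its circle. Hence the remaining product does not
  -- vanish at w', and strictness in one factor survives.
  have hw' : w'.im ≠ 0 ∨ 0 ≤ w'.re := by
    by_contra! hc
    rw [hc.1] at h
    nlinarith [sq_nonneg w.im]
  have h1 : ‖1 + (x j : ℂ) * w‖ < ‖1 + (x j : ℂ) * w'‖ := by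
    rw [← sq_lt_sq₀ (norm_nonneg _) (norm_nonneg _), Complex.sq_norm, Complex.sq_norm,
      Complex.normSq_apply, Complex.normSq_apply]
    have e : x j ^ 2 * _ = x j ^ 2 * _ := congrArg (x j ^ 2 * ·) h
    simp
    nlinarith [mul_lt_mul_of_pos_left hre hj]
  rw [canonicalProd_eq_mul_update hx hs w j, canonicalProd_eq_mul_update hx hs w' j, norm_mul,
    norm_mul]
  exact (mul_le_mul_of_nonneg_left (norm_canonicalProd_le hx' hs' hn hre.le)
    (norm_nonneg _)).trans_lt (mul_lt_mul_of_pos_right h1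
      (norm_pos_iff.2 (canonicalProd_ne_zero hx' hs' hw')))

theorem one_le_norm_canonicalProd {x : ℕ → ℝ} (hx : ∀ k, 0 ≤ x k) (hs : Summable x)
    {w : ℂ} (hw : 0 ≤ w.re) : 1 ≤ ‖canonicalProd x w‖ := by
  refine ge_of_tendsto' (hasProd_canonicalProd hx hs w).norm fun s => ?_
  rw [← Finset.prod_const_one (s := s)]
  refine Finset.prod_le_prod (fun _ _ => zero_le_one) fun k _ => ?_
  refine le_trans ?_ (Complex.abs_re_le_norm _)
  refine le_trans ?_ (le_abs_self _)
  simp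
  exact mul_nonneg (hx k) hw

theorem summable_arg_one_add {x : ℕ → ℝ} (hx : ∀ k, 0 ≤ x k) (hs : Summable x)
    (w : ℂ) : Summable fun k => (1 + (x k : ℂ) * w).arg :=
  ((summable_norm_mul_of_nonneg hx hs w).mul_left (2 * Real.pi)).of_norm_bounded
    fun _ => abs_arg_one_add_le _

theorem canonicalProd_eq_norm_mul_exp {x : ℕ → ℝ} (hx : ∀ k, 0 ≤ x k) (hs : Summable x)
    (w : ℂ) :
    canonicalProd x w = ‖canonicalProd x w‖ * Complex.exp (canonicalArg x w * Complex.I) := by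
  have h1 := (hasProd_canonicalProd hx hs w).norm.map Complex.ofRealHom Complex.continuous_ofReal
  have h2 := (((summable_arg_one_add hx hs w).hasSum.map Complex.ofRealHom
    Complex.continuous_ofReal).mul_right Complex.I).cexp
  refine (hasProd_canonicalProd hx hs w).unique ((h1.mul h2).congr_fun fun k => ?_)
  simp [Complex.norm_mul_exp_arg_mul_I]

/-- Every factor stays in the closed upper half plane without 0, where the principal argument is
continuous, and the series converges uniformly on bounded sets. So this sum is a continuous branch
up to the real axis. -/
theorem continuousOn_canonicalArg {x : ℕ → ℝ} (hx : ∀ k, 0 ≤ x k) (hs : Summable x)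
    :
    ContinuousOn (canonicalArg x) {w | 0 ≤ w.im ∧ canonicalProd x w ≠ 0} := by
  intro w₀ hw₀
  have h : ContinuousOn (canonicalArg x)
      ({w | 0 ≤ w.im ∧ canonicalProd x w ≠ 0} ∩ Metric.ball 0 (‖w₀‖ + 1)) := by
    refine continuousOn_tsum (u := fun k => 2 * Real.pi * (x k * (‖w₀‖ + 1))) (fun k w hw => ?_)
      ((hs.mul_right _).mul_left _) fun k w hw => ?_
    · refine (continuousWithinAt_arg_of_ne_zero
        (one_add_mul_ne_zero_of_canonicalProd_ne_zero hw.1.2 k)).comp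
        (f := fun w : ℂ => 1 + (x k : ℂ) * w) (by fun_prop) fun v hv => ?_
      simpa using mul_nonneg (hx k) hv.1.1
    · refine (abs_arg_one_add_le _).trans ?_
      rw [norm_mul, Complex.norm_real, Real.norm_of_nonneg (hx k)]
      have := (mem_ball_zero_iff.1 hw.2).le
      have := hx k
      gcongr
  refine (h w₀ ⟨hw₀, by simp⟩).mono_of_mem_nhdsWithin ?_
  exact inter_mem_nhdsWithin _ (Metric.isOpen_ball.mem_nhds (by simp))

theorem canonicalArg_nonneg {x : ℕ → ℝ} (hx : ∀ k, 0 ≤ x k)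
    {w : ℂ} (hw : 0 ≤ w.im) : 0 ≤ canonicalArg x w :=
  tsum_nonneg fun k => Complex.arg_nonneg_iff.2 (by simpa using mul_nonneg (hx k) hw)

theorem arg_one_add_le_canonicalArg {x : ℕ → ℝ} (hx : ∀ k, 0 ≤ x k) (hs : Summable x)
    {w : ℂ} (hw : 0 ≤ w.im) (j : ℕ) :
    (1 + (x j : ℂ) * w).arg ≤ canonicalArg x w :=
  (summable_arg_one_add hx hs w).le_tsum j fun k _ =>
    Complex.arg_nonneg_iff.2 (by simpa using mul_nonneg (hx k) hw)

/-- Each factor contributes Im(xw/(1 + xw)) = x Im w/|1 + xw|². -/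
theorem hasSum_im_mul_logDeriv_canonicalProd {x : ℕ → ℝ} (hx : ∀ k, 0 ≤ x k) (hs : Summable x)
    {w : ℂ} (hw : w.im ≠ 0) :
    HasSum (fun k => x k * w.im / Complex.normSq (1 + (x k : ℂ) * w))
      (w * logDeriv (canonicalProd x) w).im := by
  have hne := one_add_mul_ne_zero_of_canonicalProd_ne_zero
    (canonicalProd_ne_zero hx hs (Or.inl hw))
  have hld : ∀ k, logDeriv (fun w => 1 + (x k : ℂ) * w) w = x k / (1 + x k * w) := by
    intro k
    rw [logDeriv_apply]
    congr 1
    simp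
  have hsum : Summable fun k => logDeriv (fun w => 1 + (x k : ℂ) * w) w := by
    simp only [hld]
    -- The factors tend to 1, so all but finitely many denominators exceed 1/2.
    have hlim : Tendsto (fun k => ‖1 + (x k : ℂ) * w‖) cofinite (𝓝 ‖1 + ((0 : ℝ) : ℂ) * w‖) := by
      have := (Complex.continuous_ofReal.tendsto 0).comp hs.tendsto_cofinite_zero
      exact ((this.mul_const w).const_add 1).norm
    have hev : ∀ᶠ k in cofinite, 1 / 2 < ‖1 + (x k : ℂ) * w‖ :=
      hlim.eventually_const_lt (by norm_num)
    refine (hs.mul_left 2).of_norm_bounded_eventually ?_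
    filter_upwards [hev] with k hk
    rw [norm_div, Complex.norm_real, Real.norm_of_nonneg (hx k), div_le_iff₀ (by linarith)]
    nlinarith [hx k]
  have h := logDeriv_tprod_eq_tsum Metric.isOpen_ball (s := Metric.ball 0 (‖w‖ + 1))
    (x := w) (by simp) hne (fun k => by fun_prop) hsum
    (hasProdLocallyUniformlyOn_canonicalProd hx hs _).multipliableLocallyUniformlyOn
    (canonicalProd_ne_zero hx hs (Or.inl hw))
  have h' : HasSum (fun k => (w * logDeriv (fun w => 1 + (x k : ℂ) * w) w).im)
      (w * logDeriv (canonicalProd x) w).im := by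
    have h1 := Complex.hasSum_im (hsum.hasSum.mul_left w)
    rw [← h] at h1
    exact h1
  refine h'.congr_fun fun k => ?_
  rw [hld]
  have e : w * (x k / (1 + x k * w)) = (x k * w) / (1 + x k * w) := by ring
  rw [e, Complex.div_im]
  have := Complex.normSq_pos.2 (hne k)
  simp
  field_simp
  ring

theorem im_mul_im_mul_logDeriv_canonicalProd_nonneg {x : ℕ → ℝ} (hx : ∀ k, 0 ≤ x k)
    (hs : Summable x) {w : ℂ} (hw : w.im ≠ 0) :
    0 ≤ w.im * (w * logDeriv (canonicalProd x) w).im := by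
  refine ((hasSum_im_mul_logDeriv_canonicalProd hx hs hw).mul_left w.im).nonneg fun k => ?_
  rw [mul_div_assoc', mul_left_comm]
  exact div_nonneg (mul_nonneg (hx k) (mul_self_nonneg _)) (Complex.normSq_nonneg _)

theorem im_mul_im_mul_logDeriv_canonicalProd_pos {x : ℕ → ℝ} (hx : ∀ k, 0 ≤ x k)
    (hs : Summable x) {w : ℂ} (hw : w.im ≠ 0) (hpos : ∃ j, 0 < x j) :
    0 < w.im * (w * logDeriv (canonicalProd x) w).im := by
  have h := (hasSum_im_mul_logDeriv_canonicalProd hx hs hw).mul_left w.im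
  obtain ⟨j, hj⟩ := hpos
  rw [← h.tsum_eq]
  refine h.summable.tsum_pos (fun k => ?_) j ?_
  · rw [mul_div_assoc', mul_left_comm]
    exact div_nonneg (mul_nonneg (hx k) (mul_self_nonneg _)) (Complex.normSq_nonneg _)
  · rw [mul_div_assoc', mul_left_comm]
    exact div_pos (mul_pos hj (mul_self_pos.2 hw)) (Complex.normSq_pos.2
      (one_add_mul_ne_zero_of_canonicalProd_ne_zero
        (canonicalProd_ne_zero hx hs (Or.inl hw)) j))

/-- Replacing w by -w flips both signs in Im w · Im(w L), so the second product contributes with the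
same sign as the first. This positivity gives both the monotonicity of the argument and the
simplicity of the zeros. -/
theorem im_mul_im_logDeriv_add_pos {x y : ℕ → ℝ} (hx : ∀ k, 0 ≤ x k) (hxs : Summable x)
    (hy : ∀ k, 0 ≤ y k) (hys : Summable y) (hpos : (∃ j, 0 < x j) ∨ ∃ j, 0 < y j)
    {w : ℂ} (hw : w.im ≠ 0) :
    0 < w.im * (w * logDeriv (canonicalProd x) w + w * logDeriv (canonicalProd y) (-w)).im := by
  have hw' : (-w).im ≠ 0 := by simpa using hw
  have e : w.im * (w * logDeriv (canonicalProd y) (-w)).im =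
      (-w).im * (-w * logDeriv (canonicalProd y) (-w)).im := by simp; ring
  rw [Complex.add_im, mul_add, e]
  rcases hpos with h | h
  · exact add_pos_of_pos_of_nonneg (im_mul_im_mul_logDeriv_canonicalProd_pos hx hxs hw h)
      (im_mul_im_mul_logDeriv_canonicalProd_nonneg hy hys hw')
  · exact add_pos_of_nonneg_of_pos (im_mul_im_mul_logDeriv_canonicalProd_nonneg hx hxs hw)
      (im_mul_im_mul_logDeriv_canonicalProd_pos hy hys hw' h)

theorem canonicalArg_le {x : ℕ → ℝ} (hx : ∀ k, 0 ≤ x k) (hs : Summable x) (w : ℂ) :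
    canonicalArg x w ≤ 2 * Real.pi * ((∑' k, x k) * ‖w‖) := by
  rw [← tsum_mul_right, ← tsum_mul_left]
  refine (summable_arg_one_add hx hs w).tsum_le_tsum (fun k => ?_)
    ((hs.mul_right _).mul_left _)
  refine (le_abs_self _).trans ((abs_arg_one_add_le _).trans_eq ?_)
  rw [norm_mul, Complex.norm_real, Real.norm_of_nonneg (hx k)]

/-! ### The curve of equal moduli -/

/-- The point with polar coordinates `(r, θ)`. -/
noncomputable def polarPoint (r θ : ℝ) : ℂ := r * Complex.exp (θ * Complex.I)

theorem norm_polarPoint (r θ : ℝ) : ‖polarPoint r θ‖ = |r| := by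
  simp [polarPoint, Complex.norm_exp_ofReal_mul_I]

theorem polarPoint_re (r θ : ℝ) : (polarPoint r θ).re = r * Real.cos θ := by
  simp [polarPoint, Complex.exp_ofReal_mul_I_re]

theorem polarPoint_im (r θ : ℝ) : (polarPoint r θ).im = r * Real.sin θ := by
  simp [polarPoint, Complex.exp_ofReal_mul_I_im]

theorem polarPoint_pi_sub (r θ : ℝ) : polarPoint r (Real.pi - θ) = -conj (polarPoint r θ) := by
  apply Complex.ext <;> simp [polarPoint_re, polarPoint_im]

theorem continuous_polarPoint : Continuous fun p : ℝ × ℝ => polarPoint p.1 p.2 := by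
  unfold polarPoint
  fun_prop

/-- The difference of the moduli of `∏ (1 + xₖ w)` and `q √w ∏ (1 - yₖ w)` at `w = r e^{iθ}`. -/
noncomputable def modulusGap (x y : ℕ → ℝ) (q r θ : ℝ) : ℝ :=
  ‖canonicalProd x (polarPoint r θ)‖ -
    q * √r * ‖canonicalProd y (polarPoint r (Real.pi - θ))‖

/-- `θ r` is the angle in `[0, π]` at which the two moduli compared by `modulusGap` agree
on the semicircle of radius `r`, or the end of the interval that is nearest to agreement. -/
structure IsLevelAngle (x y : ℕ → ℝ) (q : ℝ) (θ : ℝ → ℝ) : Prop where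
  x_nonneg : ∀ k, 0 ≤ x k
  x_summable : Summable x
  y_nonneg : ∀ k, 0 ≤ y k
  y_summable : Summable y
  q_pos : 0 < q
  exists_pos : (∃ j, 0 < x j) ∨ ∃ j, 0 < y j
  mem_Icc : ∀ r, 0 < r → θ r ∈ Set.Icc 0 Real.pi
  gap_nonneg : ∀ r, 0 < r → 0 < θ r → 0 ≤ modulusGap x y q r (θ r)
  gap_nonpos : ∀ r, 0 < r → θ r < Real.pi → modulusGap x y q r (θ r) ≤ 0

theorem continuous_modulusGap {x y : ℕ → ℝ} (hx : ∀ k, 0 ≤ x k) (hxs : Summable x)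
    (hy : ∀ k, 0 ≤ y k) (hys : Summable y) (q : ℝ) :
    Continuous fun p : ℝ × ℝ => modulusGap x y q p.1 p.2 := by
  have h1 := (differentiable_canonicalProd hx hxs).continuous
  have h2 := (differentiable_canonicalProd hy hys).continuous
  have h3 : Continuous fun p : ℝ × ℝ => polarPoint p.1 (Real.pi - p.2) :=
    continuous_polarPoint.comp (continuous_fst.prodMk (continuous_const.sub continuous_snd))
  unfold modulusGap
  exact (h1.comp continuous_polarPoint).norm.sub
    ((continuous_const.mul (Real.continuous_sqrt.comp continuous_fst)).mul (h2.comp h3).norm)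

theorem strictAntiOn_modulusGap {x y : ℕ → ℝ} (hx : ∀ k, 0 ≤ x k) (hxs : Summable x)
    (hy : ∀ k, 0 ≤ y k) (hys : Summable y) {q r : ℝ} (hq : 0 < q) (hr : 0 < r)
    (hpos : (∃ j, 0 < x j) ∨ ∃ j, 0 < y j) :
    StrictAntiOn (modulusGap x y q r) (Set.Icc 0 Real.pi) := by
  intro a ha b hb hab
  have hcos := Real.strictAntiOn_cos ha hb hab
  have hn : ‖polarPoint r b‖ = ‖polarPoint r a‖ := by simp [norm_polarPoint]
  have hn' : ‖polarPoint r (Real.pi - a)‖ = ‖polarPoint r (Real.pi - b)‖ := by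
    simp [norm_polarPoint]
  have hre : (polarPoint r b).re < (polarPoint r a).re := by
    rw [polarPoint_re, polarPoint_re]
    exact mul_lt_mul_of_pos_left hcos hr
  have hre' : (polarPoint r (Real.pi - a)).re < (polarPoint r (Real.pi - b)).re := by
    rw [polarPoint_re, polarPoint_re, Real.cos_pi_sub, Real.cos_pi_sub]
    exact mul_lt_mul_of_pos_left (neg_lt_neg hcos) hr
  have hqr : 0 < q * √r := by positivity
  have h1 := norm_canonicalProd_le hx hxs hn hre.le
  have h2 := mul_le_mul_of_nonneg_left (norm_canonicalProd_le hy hys hn' hre'.le) hqr.le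
  unfold modulusGap
  rcases hpos with h | h
  · have := norm_canonicalProd_lt hx hxs hn hre h
    linarith
  · have := mul_lt_mul_of_pos_left (norm_canonicalProd_lt hy hys hn' hre' h) hqr
    linarith

theorem exists_isLevelAngle {x y : ℕ → ℝ} (hx : ∀ k, 0 ≤ x k) (hxs : Summable x)
    (hy : ∀ k, 0 ≤ y k) (hys : Summable y) {q : ℝ} (hq : 0 < q)
    (hpos : (∃ j, 0 < x j) ∨ ∃ j, 0 < y j) : ∃ θ, IsLevelAngle x y q θ := by
  have h : ∀ r : ℝ, ∃ t ∈ Set.Icc 0 Real.pi, (0 < t → 0 ≤ modulusGap x y q r t) ∧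
      (t < Real.pi → modulusGap x y q r t ≤ 0) := by
    intro r
    by_cases h0 : modulusGap x y q r 0 ≤ 0
    · exact ⟨0, ⟨le_rfl, Real.pi_pos.le⟩, fun h => absurd h (lt_irrefl _), fun _ => h0⟩
    by_cases hπ : 0 ≤ modulusGap x y q r Real.pi
    · exact ⟨Real.pi, ⟨Real.pi_pos.le, le_rfl⟩, fun _ => hπ, fun h => absurd h (lt_irrefl _)⟩
    have hc : ContinuousOn (modulusGap x y q r) (Set.Icc 0 Real.pi) :=
      ((continuous_modulusGap hx hxs hy hys q).comp (Continuous.prodMk_right r)).continuousOn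
    obtain ⟨t, ht, ht0⟩ := intermediate_value_Icc' Real.pi_pos.le hc
      ⟨(not_le.1 hπ).le, (not_le.1 h0).le⟩
    exact ⟨t, ht, fun _ => ht0.ge, fun _ => ht0.le⟩
  choose θ hθ h1 h2 using h
  exact ⟨θ, hx, hxs, hy, hys, hq, hpos, fun r _ => hθ r, fun r _ => h1 r, fun r _ => h2 r⟩

/-- The argument of `∏ (1 + xₖ w) / (√w ∏ (1 - yₖ w))` along the level curve. -/
noncomputable def levelArg (x y : ℕ → ℝ) (θ : ℝ → ℝ) (r : ℝ) : ℝ :=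
  canonicalArg x (polarPoint r (θ r)) + canonicalArg y (polarPoint r (Real.pi - θ r)) - θ r / 2

/-- -w is the conjugate of r e^{i(π - t)}. For t in [0, π] that point lies in the closed upper half
plane, where `canonicalArg` behaves well; conjugation produces the minus sign. -/
theorem canonicalProd_neg_polarPoint {y : ℕ → ℝ} (hy : ∀ k, 0 ≤ y k) (hys : Summable y)
    (r t : ℝ) : canonicalProd y (-polarPoint r t) =
      ‖canonicalProd y (polarPoint r (Real.pi - t))‖ *
        Complex.exp (-(canonicalArg y (polarPoint r (Real.pi - t)) * Complex.I)) := by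
  have h : -polarPoint r t = conj (polarPoint r (Real.pi - t)) := by
    simp [polarPoint_pi_sub]
  rw [h, canonicalProd_conj hy hys]
  conv_lhs => rw [canonicalProd_eq_norm_mul_exp hy hys]
  rw [map_mul, Complex.conj_ofReal, ← Complex.exp_conj]
  simp

namespace IsLevelAngle

variable {x y : ℕ → ℝ} {q : ℝ} {θ : ℝ → ℝ}

theorem strictAntiOn (h : IsLevelAngle x y q θ) {r : ℝ} (hr : 0 < r) :
    StrictAntiOn (modulusGap x y q r) (Set.Icc 0 Real.pi) :=
  strictAntiOn_modulusGap h.x_nonneg h.x_summable h.y_nonneg h.y_summable h.q_pos hr h.exists_pos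

theorem le_of_gap_nonneg (h : IsLevelAngle x y q θ) {r t : ℝ} (hr : 0 < r)
    (ht : t ∈ Set.Icc 0 Real.pi) (hg : 0 ≤ modulusGap x y q r t) : t ≤ θ r := by
  by_contra! hlt
  have := h.strictAntiOn hr (h.mem_Icc r hr) ht hlt
  linarith [h.gap_nonpos r hr (hlt.trans_le ht.2)]

theorem ge_of_gap_nonpos (h : IsLevelAngle x y q θ) {r t : ℝ} (hr : 0 < r)
    (ht : t ∈ Set.Icc 0 Real.pi) (hg : modulusGap x y q r t ≤ 0) : θ r ≤ t := by
  by_contra! hlt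
  have := h.strictAntiOn hr ht (h.mem_Icc r hr) hlt
  linarith [h.gap_nonneg r hr (ht.1.trans_lt hlt)]

theorem continuous_gap (h : IsLevelAngle x y q θ) (t : ℝ) :
    Continuous fun r => modulusGap x y q r t :=
  Continuous.comp (g := fun p : ℝ × ℝ => modulusGap x y q p.1 p.2) (f := fun r => (r, t))
    (continuous_modulusGap h.x_nonneg h.x_summable h.y_nonneg h.y_summable q)
    (continuous_id.prodMk continuous_const)

/-- At a test angle t strictly between c and θ(r₀) the gap has a strict sign. The sign persists for
r near r₀, and monotonicity in the angle keeps θ(r) on the same side of t. -/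
theorem eventually_lt_angle (h : IsLevelAngle x y q θ) {r₀ c : ℝ} (hr₀ : 0 < r₀)
    (hc : c < θ r₀) : ∀ᶠ r in 𝓝 r₀, c < θ r := by
  have hm := h.mem_Icc r₀ hr₀
  have hpos : ∀ᶠ r in 𝓝 r₀, 0 < r := lt_mem_nhds hr₀
  rcases lt_or_ge c 0 with hc0 | hc0
  · exact hpos.mono fun r hr => hc0.trans_le (h.mem_Icc r hr).1
  obtain ⟨t, hct, htθ⟩ := exists_between hc
  have htm : t ∈ Set.Icc 0 Real.pi := ⟨hc0.trans hct.le, htθ.le.trans hm.2⟩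
  have hgt : 0 < modulusGap x y q r₀ t :=
    (h.gap_nonneg r₀ hr₀ (htm.1.trans_lt htθ)).trans_lt (h.strictAntiOn hr₀ htm hm htθ)
  have hev : ∀ᶠ r in 𝓝 r₀, 0 < modulusGap x y q r t :=
    (h.continuous_gap t).continuousAt.eventually (lt_mem_nhds hgt)
  exact (hpos.and hev).mono fun r hr => hct.trans_le (h.le_of_gap_nonneg hr.1 htm hr.2.le)

theorem eventually_angle_lt (h : IsLevelAngle x y q θ) {r₀ c : ℝ} (hr₀ : 0 < r₀)
    (hc : θ r₀ < c) : ∀ᶠ r in 𝓝 r₀, θ r < c := by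
  have hm := h.mem_Icc r₀ hr₀
  have hpos : ∀ᶠ r in 𝓝 r₀, 0 < r := lt_mem_nhds hr₀
  rcases lt_or_ge Real.pi c with hcπ | hcπ
  · exact hpos.mono fun r hr => (h.mem_Icc r hr).2.trans_lt hcπ
  obtain ⟨t, htθ, hct⟩ := exists_between hc
  have htm : t ∈ Set.Icc 0 Real.pi := ⟨hm.1.trans htθ.le, hct.le.trans hcπ⟩
  have hgt : modulusGap x y q r₀ t < 0 :=
    (h.strictAntiOn hr₀ hm htm htθ).trans_le (h.gap_nonpos r₀ hr₀ (htθ.trans_le htm.2))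
  have hev : ∀ᶠ r in 𝓝 r₀, modulusGap x y q r t < 0 :=
    (h.continuous_gap t).continuousAt.eventually (gt_mem_nhds hgt)
  exact (hpos.and hev).mono fun r hr => (h.ge_of_gap_nonpos hr.1 htm hr.2.le).trans_lt hct

theorem continuousOn_angle (h : IsLevelAngle x y q θ) : ContinuousOn θ (Set.Ioi 0) :=
  continuousOn_of_forall_continuousAt fun _ hr₀ => tendsto_order.2
    ⟨fun _ hc => h.eventually_lt_angle hr₀ hc, fun _ hc => h.eventually_angle_lt hr₀ hc⟩

theorem polarPoint_im_nonneg {r t : ℝ} (hr : 0 < r) (ht : t ∈ Set.Icc 0 Real.pi) :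
    0 ≤ (polarPoint r t).im := by
  rw [polarPoint_im]
  exact mul_nonneg hr.le (Real.sin_nonneg_of_mem_Icc ht)

theorem pi_sub_mem (h : IsLevelAngle x y q θ) {r : ℝ} (hr : 0 < r) :
    Real.pi - θ r ∈ Set.Icc 0 Real.pi := by
  have := h.mem_Icc r hr
  constructor <;> linarith [this.1, this.2]

/-- Zeros of X could only be met at θ = π. There the clamping inequality reads |X| ≥ q√r |Y|, and
|Y| ≥ 1 on the positive axis. So the argument remains defined and continuous along the whole curve.
-/
theorem canonicalProd_x_ne_zero (h : IsLevelAngle x y q θ) {r : ℝ} (hr : 0 < r) :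
    canonicalProd x (polarPoint r (θ r)) ≠ 0 := by
  have hm := h.mem_Icc r hr
  rcases hm.1.eq_or_lt with h0 | h0
  · refine canonicalProd_ne_zero h.x_nonneg h.x_summable (Or.inr ?_)
    rw [polarPoint_re, ← h0]
    simp [hr.le]
  rcases hm.2.eq_or_lt with hπ | hπ
  · have h1 := h.gap_nonneg r hr h0
    have h2 : 1 ≤ ‖canonicalProd y (polarPoint r (Real.pi - θ r))‖ :=
      one_le_norm_canonicalProd h.y_nonneg h.y_summable (by simp [polarPoint_re, hπ, hr.le])
    have h3 : 0 < q * √r := mul_pos h.q_pos (Real.sqrt_pos.2 hr)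
    rw [modulusGap] at h1
    rw [← norm_pos_iff]
    nlinarith
  · refine canonicalProd_ne_zero h.x_nonneg h.x_summable (Or.inl ?_)
    rw [polarPoint_im]
    exact (mul_pos hr (Real.sin_pos_of_pos_of_lt_pi h0 hπ)).ne'

theorem canonicalProd_y_ne_zero (h : IsLevelAngle x y q θ) {r : ℝ} (hr : 0 < r) :
    canonicalProd y (polarPoint r (Real.pi - θ r)) ≠ 0 := by
  have hm := h.mem_Icc r hr
  rcases hm.2.eq_or_lt with hπ | hπ
  · refine canonicalProd_ne_zero h.y_nonneg h.y_summable (Or.inr ?_)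
    rw [polarPoint_re, hπ]
    simp [hr.le]
  rcases hm.1.eq_or_lt with h0 | h0
  · have h1 := h.gap_nonpos r hr hπ
    have h2 : 1 ≤ ‖canonicalProd x (polarPoint r (θ r))‖ :=
      one_le_norm_canonicalProd h.x_nonneg h.x_summable (by simp [polarPoint_re, ← h0, hr.le])
    rw [modulusGap] at h1
    intro h3
    rw [h3, norm_zero] at h1
    linarith
  · refine canonicalProd_ne_zero h.y_nonneg h.y_summable (Or.inl ?_)
    rw [polarPoint_im, Real.sin_pi_sub]
    exact (mul_pos hr (Real.sin_pos_of_pos_of_lt_pi h0 hπ)).ne'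

theorem continuousOn_levelArg (h : IsLevelAngle x y q θ) :
    ContinuousOn (levelArg x y θ) (Set.Ioi 0) := by
  have h1 : ContinuousOn (fun r => polarPoint r (θ r)) (Set.Ioi 0) :=
    continuous_polarPoint.comp_continuousOn (continuousOn_id.prodMk h.continuousOn_angle)
  have h2 : ContinuousOn (fun r => polarPoint r (Real.pi - θ r)) (Set.Ioi 0) :=
    continuous_polarPoint.comp_continuousOn
      (continuousOn_id.prodMk (continuousOn_const.sub h.continuousOn_angle))
  refine ((ContinuousOn.comp (continuousOn_canonicalArg h.x_nonneg h.x_summable) h1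
    fun r hr => ?_).add (ContinuousOn.comp (continuousOn_canonicalArg h.y_nonneg h.y_summable) h2
    fun r hr => ?_)).sub (h.continuousOn_angle.div_const 2)
  · exact ⟨polarPoint_im_nonneg hr (h.mem_Icc r hr), h.canonicalProd_x_ne_zero hr⟩
  · exact ⟨polarPoint_im_nonneg hr (h.pi_sub_mem hr), h.canonicalProd_y_ne_zero hr⟩

/-- The quotient of the two sides of the equation for the zeros is a unimodular number times a
positive one, and its argument is `levelArg`. -/
theorem eq_iff (h : IsLevelAngle x y q θ) {r t : ℝ} (hr : 0 < r) (ht : t ∈ Set.Ioo 0 Real.pi)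
    {η : ℂ} (hη : ‖η‖ = 1) :
    canonicalProd x (polarPoint r t) =
        q * η * polarPoint √r (t / 2) * canonicalProd y (-polarPoint r t) ↔
      t = θ r ∧ Complex.exp (levelArg x y θ r * Complex.I) = η := by
  have htI : t ∈ Set.Icc 0 Real.pi := ⟨ht.1.le, ht.2.le⟩
  have hXne : canonicalProd x (polarPoint r t) ≠ 0 := by
    refine canonicalProd_ne_zero h.x_nonneg h.x_summable (Or.inl ?_)
    rw [polarPoint_im]
    exact (mul_pos hr (Real.sin_pos_of_pos_of_lt_pi ht.1 ht.2)).ne'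
  have hX := canonicalProd_eq_norm_mul_exp h.x_nonneg h.x_summable (polarPoint r t)
  have hY := canonicalProd_neg_polarPoint h.y_nonneg h.y_summable r t
  have hYn : ‖canonicalProd y (-polarPoint r t)‖ =
      ‖canonicalProd y (polarPoint r (Real.pi - t))‖ := by
    rw [← norm_neg, polarPoint_pi_sub] at *
    rw [norm_neg, ← Complex.norm_conj (canonicalProd y (-_)),
      ← canonicalProd_conj h.y_nonneg h.y_summable, map_neg]
  -- With equal moduli the common positive factor cancels, and an equation between unimodular
  -- numbers remains.
  have key : modulusGap x y q r t = 0 →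
      (canonicalProd x (polarPoint r t) =
        q * η * polarPoint √r (t / 2) * canonicalProd y (-polarPoint r t) ↔
      Complex.exp ((canonicalArg x (polarPoint r t) +
        canonicalArg y (polarPoint r (Real.pi - t)) - t / 2 : ℝ) * Complex.I) = η) := by
    intro hg
    rw [modulusGap, sub_eq_zero] at hg
    have hne : (‖canonicalProd x (polarPoint r t)‖ : ℂ) ≠ 0 := by
      exact_mod_cast norm_ne_zero_iff.2 hXne
    have hgC : (‖canonicalProd x (polarPoint r t)‖ : ℂ) =
        q * (√r : ℝ) * ‖canonicalProd y (polarPoint r (Real.pi - t))‖ := by exact_mod_cast hg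
    have e : q * η * polarPoint √r (t / 2) * canonicalProd y (-polarPoint r t) =
        ‖canonicalProd x (polarPoint r t)‖ * (η * Complex.exp ((t / 2 : ℝ) * Complex.I) *
        Complex.exp (-(canonicalArg y (polarPoint r (Real.pi - t)) * Complex.I))) := by
      rw [hY, hgC, polarPoint]
      ring
    rw [e]
    nth_rewrite 1 [hX]
    rw [mul_right_inj' hne, mul_assoc, ← Complex.exp_add, ← div_eq_iff (Complex.exp_ne_zero _),
      ← Complex.exp_sub]
    refine Eq.congr (congrArg Complex.exp ?_) rfl
    push_cast
    ring
  constructor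
  · intro heq
    have hg : modulusGap x y q r t = 0 := by
      have := congrArg norm heq
      rw [norm_mul, norm_mul, norm_mul, hη, norm_polarPoint, hYn, Complex.norm_real,
        Real.norm_of_nonneg h.q_pos.le, abs_of_nonneg (Real.sqrt_nonneg r), mul_one] at this
      rw [modulusGap, this, sub_self]
    have htθ : t = θ r := le_antisymm (h.le_of_gap_nonneg hr htI hg.ge)
      (h.ge_of_gap_nonpos hr htI hg.le)
    refine ⟨htθ, ?_⟩
    have := (key hg).1 heq
    rw [levelArg, ← htθ]
    exact this
  · rintro ⟨htθ, hA⟩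
    have hg : modulusGap x y q r t = 0 := by
      rw [htθ] at ht ⊢
      exact le_antisymm (h.gap_nonpos r hr ht.2) (h.gap_nonneg r hr ht.1)
    refine (key hg).2 ?_
    rw [← hA, levelArg, ← htθ]

/-- A real number has its argument in πℤ. The factor 4, rather than 2, matches the term θ/2, which
is π/2 at the end θ = π. -/
theorem exp_four_mul_eq_one_of_real {u : ℂ} {c φ : ℝ} (hu : u.im = 0) (hc : c ≠ 0)
    (h : u = c * Complex.exp (φ * Complex.I)) : Complex.exp (4 * (φ * Complex.I)) = 1 := by
  have him : c * Real.sin φ = 0 := by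
    rw [h, Complex.im_ofReal_mul, Complex.exp_ofReal_mul_I_im] at hu
    exact hu
  have hs := (mul_eq_zero.1 him).resolve_left hc
  have hcos := Real.sin_sq_add_cos_sq φ
  rw [show (4 : ℂ) * (φ * Complex.I) = ((4 : ℕ) : ℂ) * (φ * Complex.I) by norm_num,
    Complex.exp_nat_mul, Complex.exp_mul_I, ← Complex.ofReal_sin, ← Complex.ofReal_cos, hs]
  rw [hs] at hcos
  have h4 : Real.cos φ ^ 4 = 1 := by nlinarith
  rw [Complex.ofReal_zero, zero_mul, add_zero]
  exact_mod_cast h4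

/-- At the ends of the interval the argument is a multiple of `π / 2`. -/
theorem mem_Ioo_of_exp_ne_one (h : IsLevelAngle x y q θ) {r : ℝ} (hr : 0 < r)
    (hA : Complex.exp (4 * (levelArg x y θ r * Complex.I)) ≠ 1) : θ r ∈ Set.Ioo 0 Real.pi := by
  have hm := h.mem_Icc r hr
  by_contra hc
  have hend : θ r = 0 ∨ θ r = Real.pi := by
    by_contra! h'
    exact hc ⟨lt_of_le_of_ne hm.1 h'.1.symm, lt_of_le_of_ne hm.2 h'.2⟩
  have hsin : Real.sin (θ r) = 0 := by rcases hend with h' | h' <;> simp [h']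
  have hreal : ∀ t : ℝ, Real.sin t = 0 → polarPoint r t = ((r * Real.cos t : ℝ) : ℂ) := by
    intro t ht
    apply Complex.ext
    · rw [polarPoint_re, Complex.ofReal_re]
    · rw [polarPoint_im, ht, Complex.ofReal_im, mul_zero]
  have h1 : Complex.exp (4 * (canonicalArg x (polarPoint r (θ r)) * Complex.I)) = 1 := by
    refine exp_four_mul_eq_one_of_real ?_ (norm_ne_zero_iff.2 (h.canonicalProd_x_ne_zero hr))
      (canonicalProd_eq_norm_mul_exp h.x_nonneg h.x_summable _)
    rw [hreal _ hsin]
    exact canonicalProd_ofReal_im h.x_nonneg h.x_summable _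
  have h2 : Complex.exp (4 * (canonicalArg y (polarPoint r (Real.pi - θ r)) * Complex.I)) = 1 := by
    refine exp_four_mul_eq_one_of_real ?_ (norm_ne_zero_iff.2 (h.canonicalProd_y_ne_zero hr))
      (canonicalProd_eq_norm_mul_exp h.y_nonneg h.y_summable _)
    rw [hreal _ (by rw [Real.sin_pi_sub, hsin])]
    exact canonicalProd_ofReal_im h.y_nonneg h.y_summable _
  have h3 : Complex.exp (4 * ((θ r / 2 : ℝ) * Complex.I)) = 1 := by
    rcases hend with h' | h'
    · simp [h']
    · rw [h', ← Complex.exp_two_pi_mul_I]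
      congr 1
      push_cast
      ring
  apply hA
  have e : 4 * ((levelArg x y θ r : ℂ) * Complex.I) =
      4 * (canonicalArg x (polarPoint r (θ r)) * Complex.I) +
      4 * (canonicalArg y (polarPoint r (Real.pi - θ r)) * Complex.I) -
      4 * ((θ r / 2 : ℝ) * Complex.I) := by
    rw [levelArg]
    push_cast
    ring
  rw [e, Complex.exp_sub, Complex.exp_add, h1, h2, h3]
  simp

end IsLevelAngle

/-! ### The argument along the curve increases through the relevant levels -/

/-- By compactness there is a last point with A ≥ v; if it lay before r₁, A would exceed v just to
its right. -/
theorem le_of_forall_eventually_lt {A : ℝ → ℝ} {v r₀ r₁ : ℝ} (hA : ContinuousOn A (Set.Icc r₀ r₁))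
    (hr : r₀ ≤ r₁) (hv : v ≤ A r₀)
    (hloc : ∀ r ∈ Set.Icc r₀ r₁, A r = v → ∀ᶠ s in 𝓝[>] r, v < A s) : v ≤ A r₁ := by
  by_contra! hlt
  have hcl : IsClosed (Set.Icc r₀ r₁ ∩ A ⁻¹' Set.Ici v) :=
    hA.preimage_isClosed_of_isClosed isClosed_Icc isClosed_Ici
  obtain ⟨t, ht, htmax⟩ := (isCompact_Icc.of_isClosed_subset hcl
    Set.inter_subset_left).exists_isGreatest ⟨r₀, ⟨le_rfl, hr⟩, hv⟩
  have ht1 : t < r₁ := lt_of_le_of_ne ht.1.2 fun h => by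
    have := ht.2
    rw [h] at this
    exact absurd hlt (not_lt.2 this)
  have hIoo : ∀ᶠ s in 𝓝[>] t, s ∈ Set.Ioo t r₁ := Ioo_mem_nhdsGT ht1
  have hgt : ∀ᶠ s in 𝓝[>] t, v < A s := by
    rcases (show v ≤ A t from ht.2).eq_or_lt with h | h
    · exact hloc t ht.1 h.symm
    · have hc : ContinuousWithinAt A (Set.Ioo t r₁) t :=
        (hA t ht.1).mono fun s hs => ⟨ht.1.1.trans hs.1.le, hs.2.le⟩
      have := hc.eventually (lt_mem_nhds h)
      rwa [nhdsWithin_Ioo_eq_nhdsGT ht1] at this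
  obtain ⟨s, hs, hvs⟩ := (hIoo.and hgt).exists
  exact absurd (htmax ⟨⟨ht.1.1.trans hs.1.le, hs.2.le⟩, hvs.le⟩) (not_le.2 hs.1)

theorem exp_log_add_mul_I {r : ℝ} (hr : 0 < r) (t : ℝ) :
    Complex.exp (Real.log r + t * Complex.I) = polarPoint r t := by
  rw [Complex.exp_add, ← Complex.ofReal_exp, Real.exp_log hr, polarPoint]

theorem exp_log_add_mul_I_div_two {r : ℝ} (hr : 0 < r) (t : ℝ) :
    Complex.exp ((Real.log r + t * Complex.I) / 2) = polarPoint √r (t / 2) := by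
  rw [← exp_log_add_mul_I (Real.sqrt_pos.2 hr), Real.log_sqrt hr.le]
  congr 1
  push_cast
  ring

namespace IsLevelAngle

variable {x y : ℕ → ℝ} {q : ℝ} {θ : ℝ → ℝ}

theorem polarPoint_im_pos {r t : ℝ} (hr : 0 < r) (ht : t ∈ Set.Ioo 0 Real.pi) :
    0 < (polarPoint r t).im := by
  rw [polarPoint_im]
  exact mul_pos hr (Real.sin_pos_of_mem_Ioo ht)

theorem hasDerivAt_quotient (h : IsLevelAngle x y q θ) {ζ : ℂ} (hζ : (Complex.exp ζ).im ≠ 0) :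
    HasDerivAt (fun ζ => canonicalProd x (Complex.exp ζ) /
        (q * Complex.exp (ζ / 2) * canonicalProd y (-Complex.exp ζ)))
      (canonicalProd x (Complex.exp ζ) /
        (q * Complex.exp (ζ / 2) * canonicalProd y (-Complex.exp ζ)) *
        (Complex.exp ζ * logDeriv (canonicalProd x) (Complex.exp ζ) +
          Complex.exp ζ * logDeriv (canonicalProd y) (-Complex.exp ζ) - 1 / 2)) ζ := by
  have hX0 := canonicalProd_ne_zero h.x_nonneg h.x_summable (Or.inl hζ)
  have hY0 : canonicalProd y (-Complex.exp ζ) ≠ 0 :=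
    canonicalProd_ne_zero h.y_nonneg h.y_summable (Or.inl (by simpa using hζ))
  have hq : (q : ℂ) ≠ 0 := by exact_mod_cast h.q_pos.ne'
  have he := Complex.hasDerivAt_exp ζ
  have hX := (differentiable_canonicalProd h.x_nonneg h.x_summable
    (Complex.exp ζ)).hasDerivAt.comp ζ he
  have hY := (differentiable_canonicalProd h.y_nonneg h.y_summable
    (-Complex.exp ζ)).hasDerivAt.comp ζ he.neg
  have hE : HasDerivAt (fun ζ : ℂ => q * Complex.exp (ζ / 2))
      (q * (Complex.exp (ζ / 2) * (1 / 2))) ζ :=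
    (((hasDerivAt_id ζ).div_const 2).cexp).const_mul _
  have hE0 := Complex.exp_ne_zero (ζ / 2)
  refine (hX.div (hE.mul hY) (mul_ne_zero (mul_ne_zero hq hE0) hY0)).congr_deriv ?_
  simp only [Function.comp_apply, Pi.neg_apply, logDeriv_apply, Pi.mul_apply]
  field_simp
  ring

/-- In the variable ζ = log w the quotient K is holomorphic, equals e^{iA} on the curve, and has
logarithmic derivative D with Im D > 0. By the Cauchy–Riemann equations its argument then grows
along |K| = 1 together with Re ζ = log r. -/
theorem eventually_levelArg_lt (h : IsLevelAngle x y q θ) {r₀ : ℝ} (hr₀ : 0 < r₀)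
    (hθ : θ r₀ ∈ Set.Ioo 0 Real.pi) :
    ∀ᶠ r in 𝓝[≠] r₀, 0 < (levelArg x y θ r - levelArg x y θ r₀) * (r - r₀) := by
  set K : ℂ → ℂ := fun ζ => canonicalProd x (Complex.exp ζ) /
        (q * Complex.exp (ζ / 2) * canonicalProd y (-Complex.exp ζ)) with hK
  set ζ : ℝ → ℂ := fun r => Real.log r + θ r * Complex.I with hζ
  set A := levelArg x y θ
  have hq : (q : ℂ) ≠ 0 := by exact_mod_cast h.q_pos.ne'
  have hKA : ∀ r, 0 < r → θ r ∈ Set.Ioo 0 Real.pi → K (ζ r) = Complex.exp (A r * Complex.I) := by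
    intro r hr hr'
    have h1 := (h.eq_iff hr hr' (Complex.norm_exp_ofReal_mul_I (A r))).2 ⟨rfl, rfl⟩
    have hY0 : canonicalProd y (-polarPoint r (θ r)) ≠ 0 :=
      canonicalProd_ne_zero h.y_nonneg h.y_summable
        (Or.inl (by simpa using (polarPoint_im_pos hr hr').ne'))
    have hE0 := Complex.exp_ne_zero ((Real.log r + θ r * Complex.I) / 2)
    rw [exp_log_add_mul_I_div_two hr] at hE0
    simp only [hK, hζ]
    rw [exp_log_add_mul_I hr, exp_log_add_mul_I_div_two hr, h1]
    field_simp
  have hw0 : (Complex.exp (ζ r₀)).im ≠ 0 := by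
    simp only [hζ]
    rw [exp_log_add_mul_I hr₀]
    exact (polarPoint_im_pos hr₀ hθ).ne'
  set D := Complex.exp (ζ r₀) * logDeriv (canonicalProd x) (Complex.exp (ζ r₀)) +
          Complex.exp (ζ r₀) * logDeriv (canonicalProd y) (-Complex.exp (ζ r₀)) - 1 / 2 with hD
  have hDim : 0 < D.im := by
    have h1 := im_mul_im_logDeriv_add_pos h.x_nonneg h.x_summable h.y_nonneg h.y_summable
      h.exists_pos hw0
    have h2 : 0 < (Complex.exp (ζ r₀)).im := by
      simp only [hζ]
      rw [exp_log_add_mul_I hr₀]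
      exact polarPoint_im_pos hr₀ hθ
    have h3 := (mul_pos_iff_of_pos_left h2).1 h1
    rw [hD, Complex.sub_im]
    simpa using h3
  have hK0 : K (ζ r₀) ≠ 0 := by rw [hKA r₀ hr₀ hθ]; exact Complex.exp_ne_zero _
  have hJ : HasDerivAt (fun z => Complex.log (K z / K (ζ r₀))) D (ζ r₀) := by
    have h1 := (h.hasDerivAt_quotient hw0).div_const (K (ζ r₀))
    have h2 := h1.clog (by
      rw [show K (ζ r₀) / K (ζ r₀) = 1 from div_self hK0]
      exact Complex.one_mem_slitPlane)
    refine h2.congr_deriv ?_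
    change K (ζ r₀) * D / K (ζ r₀) / (K (ζ r₀) / K (ζ r₀)) = D
    field_simp
  have hslope := hasDerivAt_iff_tendsto_slope.1 hJ
  have hζc : Tendsto ζ (𝓝[≠] r₀) (𝓝[≠] (ζ r₀)) := by
    refine tendsto_nhdsWithin_iff.2 ⟨?_, ?_⟩
    · have h1 : ContinuousAt θ r₀ := h.continuousOn_angle.continuousAt (Ioi_mem_nhds hr₀)
      have h2 : ContinuousAt ζ r₀ :=
        ((Complex.continuous_ofReal.continuousAt.comp (Real.continuousAt_log hr₀.ne')).add
          ((Complex.continuous_ofReal.continuousAt.comp h1).mul continuousAt_const))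
      exact h2.tendsto.mono_left nhdsWithin_le_nhds
    · have hpos : ∀ᶠ r in 𝓝[≠] r₀, 0 < r := nhdsWithin_le_nhds (lt_mem_nhds hr₀)
      filter_upwards [hpos, self_mem_nhdsWithin] with r hr hne heq
      have := congrArg Complex.re heq
      simp [hζ] at this
      exact hne (Real.log_injOn_pos hr hr₀ this)
  have hAc : ContinuousAt A r₀ := h.continuousOn_levelArg.continuousAt (Ioi_mem_nhds hr₀)
  -- Keeps within the principal branch, so that the logarithm of K(ζ r)/K(ζ r₀) is exactly i(A r - A
  -- r₀).
  have hAclose : ∀ᶠ r in 𝓝[≠] r₀, |A r - A r₀| < Real.pi := by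
    refine nhdsWithin_le_nhds ?_
    have : Tendsto (fun r => |A r - A r₀|) (𝓝 r₀) (𝓝 |A r₀ - A r₀|) :=
      (hAc.tendsto.sub_const _).abs
    exact this.eventually (gt_mem_nhds (by simpa using Real.pi_pos))
  have hsl : ∀ᶠ r in 𝓝[≠] r₀,
      0 < (slope (fun z => Complex.log (K z / K (ζ r₀))) (ζ r₀) (ζ r)).im :=
    ((Complex.continuous_im.tendsto D).comp (hslope.comp hζc)).eventually (lt_mem_nhds hDim)
  have hpos : ∀ᶠ r in 𝓝[≠] r₀, 0 < r := nhdsWithin_le_nhds (lt_mem_nhds hr₀)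
  have hlo := nhdsWithin_le_nhds (s := {r₀}ᶜ) (h.eventually_lt_angle hr₀ hθ.1)
  have hhi := nhdsWithin_le_nhds (s := {r₀}ᶜ) (h.eventually_angle_lt hr₀ hθ.2)
  filter_upwards [hpos, hlo, hhi, hAclose, hsl, self_mem_nhdsWithin] with r hr h1 h2 h3 h4 hne
  have hlog : Complex.log (K (ζ r) / K (ζ r₀)) = (A r - A r₀ : ℝ) * Complex.I := by
    rw [hKA r hr ⟨h1, h2⟩, hKA r₀ hr₀ hθ, ← Complex.exp_sub, ← sub_mul, ← Complex.ofReal_sub]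
    rw [abs_lt] at h3
    apply Complex.log_exp <;> simp <;> linarith [h3.1, h3.2]
  set s := slope (fun z => Complex.log (K z / K (ζ r₀))) (ζ r₀) (ζ r)
  have hs : s * (ζ r - ζ r₀) = (A r - A r₀ : ℝ) * Complex.I := by
    have := sub_smul_slope (fun z => Complex.log (K z / K (ζ r₀))) (ζ r₀) (ζ r)
    rw [smul_eq_mul, mul_comm, hlog, div_self hK0, Complex.log_one] at this
    simpa using this
  -- Differentiability of θ is not available. From s Δζ = iΔA, multiplying by s̄ and taking real
  -- parts eliminates Δθ.
  have hkey : (A r - A r₀) * s.im = Complex.normSq s * (Real.log r - Real.log r₀) := by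
    have e : conj s * (s * (ζ r - ζ r₀)) = Complex.normSq s * (ζ r - ζ r₀) := by
      rw [← mul_assoc, Complex.normSq_eq_conj_mul_self]
    rw [hs] at e
    have := congrArg Complex.re e
    simp [hζ] at this
    linarith
  have hn : 0 < Complex.normSq s := Complex.normSq_pos.2 fun h0 => by simp [h0] at h4
  rcases lt_or_gt_of_ne (show r ≠ r₀ from hne) with hlt | hlt
  · have h5 : Real.log r - Real.log r₀ < 0 := sub_neg.2 (Real.log_lt_log hr hlt)
    have h6 : (A r - A r₀) * s.im < 0 := by rw [hkey]; exact mul_neg_of_pos_of_neg hn h5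
    exact mul_pos_of_neg_of_neg (by nlinarith) (sub_neg.2 hlt)
  · have h5 : 0 < Real.log r - Real.log r₀ := sub_pos.2 (Real.log_lt_log hr₀ hlt)
    have h6 : 0 < (A r - A r₀) * s.im := by rw [hkey]; exact mul_pos hn h5
    exact mul_pos (pos_of_mul_pos_left h6 h4.le) (sub_pos.2 hlt)

/-- Once `levelArg` has reached a value that is not a multiple of `π / 2`, it stays above it. -/
theorem lt_levelArg_of_le (h : IsLevelAngle x y q θ) {v : ℝ}
    (hv : Complex.exp (4 * (v * Complex.I)) ≠ 1) {r₀ r₁ : ℝ} (hr₀ : 0 < r₀) (hr : r₀ < r₁)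
    (hle : v ≤ levelArg x y θ r₀) : v < levelArg x y θ r₁ := by
  have hloc : ∀ r, 0 < r → levelArg x y θ r = v →
      ∀ᶠ s in 𝓝[≠] r, 0 < (levelArg x y θ s - v) * (s - r) := by
    intro r hr hA
    have := h.eventually_levelArg_lt hr (h.mem_Ioo_of_exp_ne_one hr (by rwa [hA]))
    rwa [hA] at this
  have hweak : ∀ r, r₀ ≤ r → v ≤ levelArg x y θ r := by
    intro r hr
    refine le_of_forall_eventually_lt
      (h.continuousOn_levelArg.mono fun s hs => hr₀.trans_le hs.1) hr hle fun s hs hA => ?_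
    have h1 := (hloc s (hr₀.trans_le hs.1) hA).filter_mono (nhdsWithin_mono s fun t ht => ne_of_gt ht)
    filter_upwards [h1, self_mem_nhdsWithin] with t ht hst
    exact sub_pos.1 (pos_of_mul_pos_left ht (sub_pos.2 hst).le)
  -- Equality at r₁ would force values below v immediately to its left, against the weak inequality.
  refine (hweak r₁ hr.le).lt_of_ne fun heq => ?_
  have h1 := (hloc r₁ (hr₀.trans hr) heq.symm).filter_mono
    (nhdsWithin_mono r₁ (s := Set.Iio r₁) fun t ht => ne_of_lt ht)
  have h2 : ∀ᶠ s in 𝓝[<] r₁, s ∈ Set.Ioo r₀ r₁ := Ioo_mem_nhdsLT hr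
  obtain ⟨s, hs1, hs2⟩ := (h1.and h2).exists
  nlinarith [hweak s hs2.1.le, hs2.2]

theorem neg_angle_div_two_le_levelArg (h : IsLevelAngle x y q θ) {r : ℝ} (hr : 0 < r) :
    -(θ r / 2) ≤ levelArg x y θ r := by
  have h1 := canonicalArg_nonneg h.x_nonneg (polarPoint_im_nonneg hr (h.mem_Icc r hr))
  have h2 := canonicalArg_nonneg h.y_nonneg (polarPoint_im_nonneg hr (h.pi_sub_mem hr))
  rw [levelArg]
  linarith

/-- The gap is 1 at r = 0, so θ = π for small r. Then A is -π/2 plus arguments of total size at most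
2πSr, which is below π/4 once r < 1/(8(S + 1)). -/
theorem exists_levelArg_lt (h : IsLevelAngle x y q θ) :
    ∃ r, 0 < r ∧ levelArg x y θ r < -(Real.pi / 4) := by
  set S := (∑' k, x k) + ∑' k, y k
  have hS : 0 ≤ S := add_nonneg (tsum_nonneg h.x_nonneg) (tsum_nonneg h.y_nonneg)
  have h1 : ∀ᶠ r in 𝓝[>] (0 : ℝ), 0 < modulusGap x y q r Real.pi := by
    refine nhdsWithin_le_nhds ((h.continuous_gap Real.pi).continuousAt.eventually (lt_mem_nhds ?_))
    simp [modulusGap, polarPoint, canonicalProd]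
  have h2 : ∀ᶠ r in 𝓝[>] (0 : ℝ), r ∈ Set.Ioo 0 (1 / (8 * (S + 1))) :=
    Ioo_mem_nhdsGT (by positivity)
  obtain ⟨r, hg, hr, hr'⟩ := (h1.and h2).exists
  refine ⟨r, hr, ?_⟩
  have hθ : θ r = Real.pi := le_antisymm (h.mem_Icc r hr).2
    (h.le_of_gap_nonneg hr ⟨Real.pi_pos.le, le_rfl⟩ hg.le)
  have hx := canonicalArg_le h.x_nonneg h.x_summable (polarPoint r (θ r))
  have hy := canonicalArg_le h.y_nonneg h.y_summable (polarPoint r (Real.pi - θ r))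
  rw [norm_polarPoint, abs_of_pos hr] at hx hy
  rw [lt_div_iff₀ (by positivity)] at hr'
  have h3 : S * r < 1 / 8 := by nlinarith
  have h4 : 2 * Real.pi * (S * r) < 2 * Real.pi * (1 / 8) :=
    mul_lt_mul_of_pos_left h3 (by positivity)
  rw [levelArg]
  have e : 2 * Real.pi * (S * r) =
    2 * Real.pi * ((∑' k, x k) * r) + 2 * Real.pi * ((∑' k, y k) * r) := by ring
  linarith

/-- If some xⱼ > 0, then at r = 1/xⱼ the single factor 1 + e^{iθ} has argument θ/2, which already
compensates -θ/2. If X = 1, choose r with q√r = 2: at angle π/2 the gap is 1 - 2|Y| < 0, so θ < π/2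
and A ≥ -θ/2 > -π/4. -/
theorem exists_lt_levelArg (h : IsLevelAngle x y q θ) :
    ∃ r, 0 < r ∧ -(Real.pi / 4) < levelArg x y θ r := by
  by_cases hx : ∃ j, 0 < x j
  · obtain ⟨j, hj⟩ := hx
    have hr : 0 < (x j)⁻¹ := inv_pos.2 hj
    refine ⟨(x j)⁻¹, hr, ?_⟩
    set r := (x j)⁻¹
    have hm := h.mem_Icc r hr
    have hxr : (x j : ℂ) * r = 1 := by
      rw [← Complex.ofReal_mul, mul_inv_cancel₀ hj.ne', Complex.ofReal_one]
    have hne : 1 + (x j : ℂ) * polarPoint r (θ r) ≠ 0 :=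
      one_add_mul_ne_zero_of_canonicalProd_ne_zero (h.canonicalProd_x_ne_zero hr) j
    have hθ : θ r < Real.pi := by
      refine hm.2.lt_of_ne fun heq => hne ?_
      rw [heq, polarPoint, Complex.exp_pi_mul_I, ← mul_assoc, hxr]
      norm_num
    have harg : (1 + (x j : ℂ) * polarPoint r (θ r)).arg = θ r / 2 := by
      have hcos : 0 < 2 * Real.cos (θ r / 2) := by
        have := Real.cos_pos_of_mem_Ioo (x := θ r / 2) ⟨by linarith [hm.1, Real.pi_pos], by linarith⟩
        linarith
      have e : 1 + (x j : ℂ) * polarPoint r (θ r) = (2 * Real.cos (θ r / 2) : ℝ) *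
          (Complex.cos (θ r / 2 : ℝ) + Complex.sin (θ r / 2 : ℝ) * Complex.I) := by
        rw [polarPoint, ← mul_assoc, hxr, one_mul]
        apply Complex.ext
        · rw [Complex.add_re, Complex.exp_ofReal_mul_I_re, Complex.re_ofReal_mul,
            ← Complex.exp_mul_I, Complex.exp_ofReal_mul_I_re, Complex.one_re]
          have := Real.cos_sq (θ r / 2)
          rw [mul_div_cancel₀ _ (two_ne_zero)] at this
          nlinarith
        · rw [Complex.add_im, Complex.exp_ofReal_mul_I_im, Complex.im_ofReal_mul,
            ← Complex.exp_mul_I, Complex.exp_ofReal_mul_I_im, Complex.one_im]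
          have := Real.sin_two_mul (θ r / 2)
          rw [mul_div_cancel₀ _ (two_ne_zero)] at this
          linarith
      rw [e, Complex.arg_mul_cos_add_sin_mul_I hcos]
      constructor <;> linarith [hm.1, Real.pi_pos]
    have h1 := arg_one_add_le_canonicalArg h.x_nonneg h.x_summable
      (polarPoint_im_nonneg hr hm) j
    have h2 := canonicalArg_nonneg h.y_nonneg (polarPoint_im_nonneg hr (h.pi_sub_mem hr))
    rw [levelArg]
    linarith [Real.pi_pos]
  · push Not at hx
    have hx0 : ∀ k, x k = 0 := fun k => le_antisymm (hx k) (h.x_nonneg k)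
    have hq := h.q_pos
    refine ⟨(2 / q) ^ 2, by positivity, ?_⟩
    set r := (2 / q) ^ 2
    have hr : 0 < r := by positivity
    have hsq : q * √r = 2 := by
      rw [Real.sqrt_sq (by positivity)]
      field_simp
    have hg : modulusGap x y q r (Real.pi / 2) < 0 := by
      have h1 : 1 ≤ ‖canonicalProd y (polarPoint r (Real.pi - Real.pi / 2))‖ :=
        one_le_norm_canonicalProd h.y_nonneg h.y_summable
          (by rw [polarPoint_re, Real.cos_pi_sub, Real.cos_pi_div_two]; simp)
      rw [modulusGap, hsq]
      simp only [canonicalProd, hx0, Complex.ofReal_zero, zero_mul, add_zero, tprod_one, norm_one]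
      simp only [canonicalProd] at h1
      linarith
    have hmem : Real.pi / 2 ∈ Set.Icc 0 Real.pi := by
      constructor <;> linarith [Real.pi_pos]
    have hθ : θ r < Real.pi / 2 := by
      refine (h.ge_of_gap_nonpos hr hmem hg.le).lt_of_ne fun heq => ?_
      have := h.gap_nonneg r hr (by rw [heq]; linarith [Real.pi_pos])
      rw [heq] at this
      linarith
    linarith [h.neg_angle_div_two_le_levelArg hr]

end IsLevelAngle

/-! ### Lists of simple zeros and their symmetries -/

/-- `z 0, z 1, …` (the terms `z k` with `k < ω`) are the zeros of `F`, all simple, ordered by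
strictly increasing moduli, and none of them lies on the axes. -/
structure IsSimpleZeroList (F : ℂ → ℂ) (ω : ℕ∞) (z : ℕ → ℂ) : Prop where
  entire : Differentiable ℂ F
  one_le : 1 ≤ ω
  eq_zero : ∀ k : ℕ, (k : ℕ∞) < ω → F (z k) = 0
  deriv_ne_zero : ∀ k : ℕ, (k : ℕ∞) < ω → deriv F (z k) ≠ 0
  complete : ∀ a, F a = 0 → ∃ k : ℕ, (k : ℕ∞) < ω ∧ z k = a
  strict : ∀ k : ℕ, ((k + 1 : ℕ) : ℕ∞) < ω → ‖z k‖ < ‖z (k + 1)‖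
  off_axes : ∀ k : ℕ, (k : ℕ∞) < ω → ((z k) ^ 2).im ≠ 0

namespace IsSimpleZeroList

variable {F : ℂ → ℂ} {ω : ℕ∞} {z : ℕ → ℂ}

theorem norm_lt (h : IsSimpleZeroList F ω z) {j k : ℕ} (hjk : j < k) (hk : (k : ℕ∞) < ω) :
    ‖z j‖ < ‖z k‖ := by
  induction k, hjk using Nat.le_induction with
  | base => exact h.strict j hk
  | succ k hjk ih =>
    exact (ih (lt_of_le_of_lt (by exact_mod_cast k.le_succ) hk)).trans (h.strict k hk)

theorem injective (h : IsSimpleZeroList F ω z) {j k : ℕ} (hj : (j : ℕ∞) < ω)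
    (hk : (k : ℕ∞) < ω) (heq : z j = z k) : j = k := by
  rcases lt_trichotomy j k with hlt | hlt | hlt
  · exact absurd (congrArg norm heq) (h.norm_lt hlt hk).ne
  · exact hlt
  · exact absurd (congrArg norm heq) (h.norm_lt hlt hj).ne'

theorem analyticOrderAt_eq_one (h : IsSimpleZeroList F ω z) {k : ℕ} (hk : (k : ℕ∞) < ω) :
    analyticOrderAt F (z k) = 1 :=
  (h.entire.analyticAt _).analyticOrderAt_eq_one_of_zero_deriv_ne_zero (h.eq_zero k hk)
    (h.deriv_ne_zero k hk)

theorem separatedZeros (h : IsSimpleZeroList F ω z) : SeparatedZeros F ω z where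
  entire := h.entire
  one_le := h.one_le
  multiplicity a := by
    by_cases ha : F a = 0
    · obtain ⟨k, hk, rfl⟩ := h.complete a ha
      rw [h.analyticOrderAt_eq_one hk, Set.encard_eq_one]
      refine ⟨k, Set.eq_singleton_iff_unique_mem.2 ⟨⟨hk, rfl⟩, fun j hj => ?_⟩⟩
      exact h.injective hj.1 hk hj.2
    · rw [(h.entire.analyticAt a).analyticOrderAt_eq_zero.2 ha, Set.encard_eq_zero]
      refine Set.eq_empty_of_forall_notMem fun k hk => ha ?_
      rw [← hk.2]
      exact h.eq_zero k hk.1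
  simple k hk := h.analyticOrderAt_eq_one hk
  pos := norm_pos_iff.2 fun h0 => h.off_axes 0 (by exact_mod_cast zero_lt_one.trans_le h.one_le)
    (by simp [h0])
  strict := h.strict
  off_axes := h.off_axes

theorem const_mul_comp_mul (h : IsSimpleZeroList F ω z) {C : ℂ} (hC : C ≠ 0) {σ : ℂ}
    (hσ : σ ^ 2 = 1) : IsSimpleZeroList (fun a => C * F (σ * a)) ω fun k => σ * z k := by
  have hσσ : ∀ a, σ * (σ * a) = a := fun a => by rw [← mul_assoc, ← sq, hσ, one_mul]
  have hσ0 : σ ≠ 0 := fun h0 => by simp [h0] at hσ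
  have hσn : ‖σ‖ = 1 := by
    have := congrArg norm hσ
    rw [norm_pow, norm_one] at this
    exact (pow_eq_one_iff_of_nonneg (norm_nonneg _) two_ne_zero).1 this
  refine ⟨?_, h.one_le, fun k hk => ?_, fun k hk => ?_, fun a ha => ?_, fun k hk => ?_,
    fun k hk => ?_⟩
  · exact (h.entire.comp (differentiable_id.const_mul σ)).const_mul C
  · simp only [hσσ]
    rw [h.eq_zero k hk, mul_zero]
  · have h1 : HasDerivAt (fun a => C * F (σ * a)) (C * (deriv F (σ * (σ * z k)) * σ))
        (σ * z k) := by
      have h2 : HasDerivAt (fun a => σ * a) σ (σ * z k) := by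
        simpa using (hasDerivAt_id (σ * z k)).const_mul σ
      exact ((h.entire (σ * (σ * z k))).hasDerivAt.comp (σ * z k) h2).const_mul C
    rw [h1.deriv, hσσ]
    exact mul_ne_zero hC (mul_ne_zero (h.deriv_ne_zero k hk) hσ0)
  · obtain ⟨k, hk, hz⟩ := h.complete (σ * a) ((mul_eq_zero.1 ha).resolve_left hC)
    exact ⟨k, hk, by rw [hz, hσσ]⟩
  · rw [norm_mul, norm_mul, hσn, one_mul, one_mul]
    exact h.strict k hk
  · rw [mul_pow, hσ, one_mul]
    exact h.off_axes k hk

theorem conj_comp_conj (h : IsSimpleZeroList F ω z) :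
    IsSimpleZeroList (fun a => conj (F (conj a))) ω fun k => conj (z k) := by
  refine ⟨?_, h.one_le, fun k hk => ?_, fun k hk => ?_, fun a ha => ?_, fun k hk => ?_,
    fun k hk => ?_⟩
  · intro a
    have := (h.entire (conj a)).conj_conj
    rwa [Complex.conj_conj] at this
  · simp [h.eq_zero k hk]
  · have := congrFun (deriv_conj_conj (f := F)) (conj (z k))
    simp only [Function.comp_def, Complex.conj_conj] at this
    rw [this]
    simpa using h.deriv_ne_zero k hk
  · obtain ⟨k, hk, hz⟩ := h.complete (conj a) (by simpa using ha)
    exact ⟨k, hk, by simp [hz]⟩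
  · simpa using h.strict k hk
  · simpa [← map_pow] using h.off_axes k hk

end IsSimpleZeroList

/-- Produces the length ω of the list from the downward closed set of attained levels. -/
theorem exists_enat_lt_iff {K : ℕ → Prop} (hK : ∀ k, K (k + 1) → K k) :
    ∃ ω : ℕ∞, ∀ k : ℕ, (k : ℕ∞) < ω ↔ K k := by
  classical
  by_cases hall : ∀ k, K k
  · exact ⟨⊤, fun k => by simp [hall k]⟩
  · push Not at hall
    refine ⟨(Nat.find hall : ℕ), fun k => ?_⟩
    rw [Nat.cast_lt, Nat.lt_find_iff]
    refine ⟨fun h => not_not.1 (h k le_rfl), fun hk m hm => not_not.2 ?_⟩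
    exact Nat.decreasingInduction' (P := K) (fun j _ _ => hK j) hm hk

/-! ### Reduction of the four quadrants to the first -/

/-- The four points `z, z̄, -z, -z̄`, one in each quadrant. -/
noncomputable def quadrantPoint (k : ℕ) (z : ℂ) : ℂ :=
  if k % 4 = 0 then z else if k % 4 = 1 then conj z else if k % 4 = 2 then -z else -conj z

theorem norm_quadrantPoint (k : ℕ) (z : ℂ) : ‖quadrantPoint k z‖ = ‖z‖ := by
  unfold quadrantPoint
  split_ifs <;> simp

theorem quadrantPoint_add_mul_four (j n : ℕ) (z : ℂ) :
    quadrantPoint (j + 4 * n) z = quadrantPoint j z := by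
  simp [quadrantPoint]

theorem im_quadrantPoint_sq_ne_zero {z : ℂ} (hz : z ∈ quadrant 0) (k : ℕ) :
    ((quadrantPoint k z) ^ 2).im ≠ 0 := by
  have h1 : 0 < z.re := hz.1
  have h2 : 0 < z.im := hz.2
  have h3 := mul_pos h1 h2
  have e : (z ^ 2).im = 2 * (z.re * z.im) := by rw [sq, Complex.mul_im]; ring
  unfold quadrantPoint
  split_ifs
  · rw [e]; positivity
  · rw [← map_pow, Complex.conj_im, e]; linarith
  · rw [neg_sq, e]; positivity
  · rw [neg_sq, ← map_pow, Complex.conj_im, e]; linarith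

theorem exists_quadrantPoint_eq {a : ℂ} (ha : (a ^ 2).im ≠ 0) :
    ∃ j z, z ∈ quadrant 0 ∧ a = quadrantPoint j z := by
  have e : (a ^ 2).im = 2 * (a.re * a.im) := by rw [sq, Complex.mul_im]; ring
  rw [e] at ha
  have hre : a.re ≠ 0 := fun h => ha (by simp [h])
  have him : a.im ≠ 0 := fun h => ha (by simp [h])
  rcases lt_or_gt_of_ne hre with h1 | h1 <;> rcases lt_or_gt_of_ne him with h2 | h2
  · exact ⟨2, -a, ⟨by simpa using h1, by simpa using h2⟩, by simp [quadrantPoint]⟩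
  · exact ⟨3, -conj a, ⟨by simpa using h1, by simpa using h2⟩, by simp [quadrantPoint]⟩
  · exact ⟨1, conj a, ⟨by simpa using h1, by simpa using h2⟩, by simp [quadrantPoint]⟩
  · exact ⟨0, a, ⟨h1, h2⟩, by simp [quadrantPoint]⟩

theorem quadrantPoint_succ_mem {z w : ℂ} (hz : z ∈ quadrant 0) (hw : w ∈ quadrant 0) (k : ℕ)
    {l : Fin 4} (hl : quadrantPoint k z ∈ quadrant l) :
    quadrantPoint (k + 1) w ∈ quadrant (l - 1) := by
  have h1 : 0 < z.re ∧ 0 < z.im := hz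
  have h2 : 0 < w.re ∧ 0 < w.im := hw
  have hk : k % 4 = 0 ∨ k % 4 = 1 ∨ k % 4 = 2 ∨ k % 4 = 3 := by omega
  rcases hk with hk | hk | hk | hk <;>
    · have hk' := Nat.add_mod k 1 4
      rw [hk] at hk'
      simp only [quadrantPoint, hk, hk'] at hl ⊢
      fin_cases l <;> simp [quadrant] at hl ⊢ <;> 
        first
        | exact absurd hl.1 (by linarith)
        | exact absurd hl.2 (by linarith)
        | exact h2

/-- The `k`-th argument at which a zero lies on the level curve. -/
noncomputable def targetArg (k : ℕ) : ℝ := -(Real.pi / 4) + k * (Real.pi / 2)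

theorem exp_targetArg_mul_I (k : ℕ) :
    Complex.exp (targetArg k * Complex.I) =
      quadrantPoint k (Complex.exp (-(Real.pi / 4) * Complex.I)) := by
  have hconj : conj (Complex.exp (-(Real.pi / 4) * Complex.I)) =
      Complex.exp ((Real.pi / 4) * Complex.I) := by
    rw [← Complex.exp_conj]
    simp [map_ofNat (starRingEnd ℂ) 4]
  have hk : k % 4 + 4 * (k / 4) = k := Nat.mod_add_div k 4
  have hj : k % 4 < 4 := Nat.mod_lt _ (by norm_num)
  rw [← hk, quadrantPoint_add_mul_four]
  generalize k % 4 = j at hj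
  generalize k / 4 = n
  have e : ((targetArg (j + 4 * n) : ℝ) : ℂ) * Complex.I =
      (targetArg j : ℂ) * Complex.I + (n : ℂ) * (2 * Real.pi * Complex.I) := by
    simp only [targetArg]
    push_cast
    ring
  rw [e, Complex.exp_add, Complex.exp_nat_mul_two_pi_mul_I, mul_one]
  interval_cases j
  · simp [targetArg, quadrantPoint]
  · simp only [quadrantPoint, hconj]
    norm_num
    congr 1
    simp [targetArg]
    ring
  · simp only [quadrantPoint]
    norm_num
    rw [← Complex.exp_add_pi_mul_I]
    congr 1
    simp [targetArg]
    ring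
  · simp only [quadrantPoint, hconj]
    norm_num
    rw [← Complex.exp_add_pi_mul_I]
    congr 1
    simp [targetArg]
    ring

theorem exp_four_targetArg (k : ℕ) : Complex.exp (4 * (targetArg k * Complex.I)) ≠ 1 := by
  have e : (4 : ℂ) * (targetArg k * Complex.I) =
      (k : ℂ) * (2 * Real.pi * Complex.I) - Real.pi * Complex.I := by
    simp only [targetArg]
    push_cast
    ring
  rw [e, Complex.exp_sub, Complex.exp_nat_mul_two_pi_mul_I, Complex.exp_pi_mul_I]
  norm_num

/-- The function `∏ (1 + xₖ z²) - q e^{-iπ/4} z ∏ (1 - yₖ z²)`. -/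
noncomputable def splitProd (x y : ℕ → ℝ) (q : ℝ) (z : ℂ) : ℂ :=
  canonicalProd x (z ^ 2) -
    q * Complex.exp (-(Real.pi / 4) * Complex.I) * z * canonicalProd y (-z ^ 2)

theorem exp_neg_pi_div_four_sq :
    Complex.exp (-(Real.pi / 4) * Complex.I) ^ 2 = -Complex.I := by
  rw [← Complex.exp_nat_mul, ← Complex.exp_neg_pi_div_two_mul_I]
  congr 1
  push_cast
  ring

theorem exp_neg_pi_div_four :
    Complex.exp (-(Real.pi / 4) * Complex.I) = (√2 / 2 : ℝ) - (√2 / 2 : ℝ) * Complex.I := by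
  have h : (-(Real.pi / 4) * Complex.I : ℂ) = ((-(Real.pi / 4) : ℝ) : ℂ) * Complex.I := by
    push_cast; ring
  rw [h]
  apply Complex.ext
  · rw [Complex.exp_ofReal_mul_I_re, Real.cos_neg, Real.cos_pi_div_four]
    simp
  · rw [Complex.exp_ofReal_mul_I_im, Real.sin_neg, Real.sin_pi_div_four]
    simp

theorem splitProd_quadrantPoint_eq_zero_iff {x y : ℕ → ℝ} (hx : ∀ k, 0 ≤ x k) (hxs : Summable x)
    (hy : ∀ k, 0 ≤ y k) (hys : Summable y) (q : ℝ) (k : ℕ) (z : ℂ) :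
    splitProd x y q (quadrantPoint k z) = 0 ↔
      canonicalProd x (z ^ 2) =
        q * Complex.exp (targetArg k * Complex.I) * z * canonicalProd y (-z ^ 2) := by
  have hX := canonicalProd_conj hx hxs (z ^ 2)
  have hY := canonicalProd_conj hy hys (-z ^ 2)
  have hinj : ∀ a b : ℂ, conj a = b ↔ a = conj b := fun a b =>
    ⟨fun h => by rw [← h, Complex.conj_conj], fun h => by rw [h, Complex.conj_conj]⟩
  rw [exp_targetArg_mul_I, splitProd, sub_eq_zero]
  unfold quadrantPoint
  split_ifs
  · rfl
  · rw [← map_pow, ← map_neg, hX, hY, hinj]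
    simp only [map_mul, Complex.conj_conj, Complex.conj_ofReal]
  · rw [neg_sq]
    simp only [mul_neg, neg_mul]
  · have hY' : canonicalProd y (-conj (z ^ 2)) = conj (canonicalProd y (-z ^ 2)) := by
      rw [← map_neg, hY]
    rw [neg_sq, ← map_pow, hX, hY', hinj]
    simp only [map_mul, map_neg, Complex.conj_conj, Complex.conj_ofReal, mul_neg, neg_mul]

/-- If w = a² is real, squaring the equation gives X(w)² = -i q² w Y(-w)², so both sides vanish. But
X(w) = 0 forces w < 0, where Y(-w) ≠ 0. -/
theorem im_sq_ne_zero_of_splitProd_eq_zero {x y : ℕ → ℝ} (hx : ∀ k, 0 ≤ x k) (hxs : Summable x)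
    (hy : ∀ k, 0 ≤ y k) (hys : Summable y) {q : ℝ} (hq : 0 < q) {a : ℂ}
    (ha : splitProd x y q a = 0) : (a ^ 2).im ≠ 0 := by
  intro him
  have hw : a ^ 2 = ((a ^ 2).re : ℂ) := Complex.ext rfl (by simpa using him)
  set ρ := (a ^ 2).re
  rw [splitProd, sub_eq_zero] at ha
  have hXr : ((canonicalProd x (ρ : ℂ)).re : ℂ) = canonicalProd x (ρ : ℂ) :=
    Complex.ext rfl (by simp [canonicalProd_ofReal_im hx hxs])
  have hYr : ((canonicalProd y ((-ρ : ℝ) : ℂ)).re : ℂ) = canonicalProd y ((-ρ : ℝ) : ℂ) :=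
    Complex.ext rfl (by rw [canonicalProd_ofReal_im hy hys]; simp)
  set X := (canonicalProd x (ρ : ℂ)).re
  set Y := (canonicalProd y ((-ρ : ℝ) : ℂ)).re
  have hsq : (X : ℂ) ^ 2 = -(q ^ 2 * ρ * Y ^ 2 : ℝ) * Complex.I := by
    have h1 := congrArg (· ^ 2) ha
    simp only [mul_pow, exp_neg_pi_div_four_sq] at h1
    rw [hw, ← Complex.ofReal_neg, ← hXr, ← hYr] at h1
    rw [h1]
    push_cast
    ring
  have hre := congrArg Complex.re hsq
  have hi := congrArg Complex.im hsq
  rw [← Complex.ofReal_pow, ← Complex.ofReal_neg] at hre hi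
  simp only [Complex.ofReal_re, Complex.ofReal_im, Complex.re_ofReal_mul, Complex.im_ofReal_mul,
    Complex.I_re, Complex.I_im, mul_zero, mul_one] at hre hi
  have hX0 : X = 0 := by simpa using hre
  have hρ : ρ < 0 := by
    by_contra! h
    refine canonicalProd_ne_zero hx hxs (w := (ρ : ℂ)) (Or.inr (by simpa using h)) ?_
    rw [← hXr, hX0, Complex.ofReal_zero]
  have hY0 : Y ≠ 0 := by
    intro h
    refine canonicalProd_ne_zero hy hys (w := ((-ρ : ℝ) : ℂ))
      (Or.inr (by rw [Complex.ofReal_re]; linarith)) ?_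
    rw [← hYr, h, Complex.ofReal_zero]
  have : q ^ 2 * ρ * Y ^ 2 < 0 :=
    mul_neg_of_neg_of_pos (mul_neg_of_pos_of_neg (by positivity) hρ) (by positivity)
  linarith

theorem hasDerivAt_splitProd {x y : ℕ → ℝ} (hx : ∀ k, 0 ≤ x k) (hxs : Summable x)
    (hy : ∀ k, 0 ≤ y k) (hys : Summable y) (q : ℝ) (a : ℂ) :
    HasDerivAt (splitProd x y q)
      (deriv (canonicalProd x) (a ^ 2) * (2 * a) -
        (q * Complex.exp (-(Real.pi / 4) * Complex.I) * canonicalProd y (-a ^ 2) +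
          q * Complex.exp (-(Real.pi / 4) * Complex.I) * a *
            (deriv (canonicalProd y) (-a ^ 2) * (-(2 * a))))) a := by
  have h1 : HasDerivAt (fun z : ℂ => z ^ 2) (2 * a) a := by simpa using hasDerivAt_pow 2 a
  have hX := (differentiable_canonicalProd hx hxs (a ^ 2)).hasDerivAt.comp a h1
  have hY := (differentiable_canonicalProd hy hys (-a ^ 2)).hasDerivAt.comp a h1.neg
  have hL : HasDerivAt (fun z : ℂ => q * Complex.exp (-(Real.pi / 4) * Complex.I) * z)
      (q * Complex.exp (-(Real.pi / 4) * Complex.I)) a := by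
    simpa using (hasDerivAt_id a).const_mul (q * Complex.exp (-(Real.pi / 4) * Complex.I))
  exact hX.sub (hL.mul hY)

/-- At a multiple zero, wX'/X(w) + wY'/Y(-w) would equal 1/2 with w = a². That is real, against
`im_mul_im_logDeriv_add_pos`; the 1/2 comes from √w. -/
theorem deriv_splitProd_ne_zero {x y : ℕ → ℝ} (hx : ∀ k, 0 ≤ x k) (hxs : Summable x)
    (hy : ∀ k, 0 ≤ y k) (hys : Summable y) (hpos : (∃ j, 0 < x j) ∨ ∃ j, 0 < y j)
    {q : ℝ} {a : ℂ} (him : (a ^ 2).im ≠ 0) (ha : splitProd x y q a = 0) :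
    deriv (splitProd x y q) a ≠ 0 := by
  intro h0
  rw [(hasDerivAt_splitProd hx hxs hy hys q a).deriv] at h0
  rw [splitProd, sub_eq_zero] at ha
  have hX := canonicalProd_ne_zero hx hxs (Or.inl him)
  have hY : canonicalProd y (-a ^ 2) ≠ 0 := canonicalProd_ne_zero hy hys (Or.inl (by simpa using him))
  have hp := im_mul_im_logDeriv_add_pos hx hxs hy hys hpos him
  have e : a ^ 2 * logDeriv (canonicalProd x) (a ^ 2) +
      a ^ 2 * logDeriv (canonicalProd y) (-a ^ 2) = ((1 / 2 : ℝ) : ℂ) := by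
    simp only [logDeriv_apply]
    set c := q * Complex.exp (-(Real.pi / 4) * Complex.I)
    set Y := canonicalProd y (-a ^ 2)
    set X' := deriv (canonicalProd x) (a ^ 2)
    set Y' := deriv (canonicalProd y) (-a ^ 2)
    rw [ha] at hX ⊢
    have hc : c ≠ 0 := fun h => hX (by rw [h]; ring)
    have ha0 : a ≠ 0 := fun h => hX (by rw [h]; ring)
    push_cast
    field_simp
    linear_combination h0
  rw [e] at hp
  simp at hp

theorem polarPoint_sq (r t : ℝ) (hr : 0 ≤ r) : polarPoint √r (t / 2) ^ 2 = polarPoint r t := by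
  rw [polarPoint, polarPoint, mul_pow, ← Complex.exp_nat_mul, ← Complex.ofReal_pow, Real.sq_sqrt hr]
  congr 2
  push_cast
  ring

theorem polarPoint_half_mem_quadrant {r t : ℝ} (hr : 0 < r) (ht : t ∈ Set.Ioo 0 Real.pi) :
    polarPoint √r (t / 2) ∈ quadrant 0 := by
  have h := Real.sqrt_pos.2 hr
  constructor
  · rw [polarPoint_re]
    exact mul_pos h (Real.cos_pos_of_mem_Ioo ⟨by linarith [ht.1, Real.pi_pos], by linarith [ht.2]⟩)
  · rw [polarPoint_im]
    exact mul_pos h (Real.sin_pos_of_mem_Ioo ⟨by linarith [ht.1], by linarith [ht.2, Real.pi_pos]⟩)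

theorem exists_polarPoint_of_mem_quadrant {z : ℂ} (hz : z ∈ quadrant 0) :
    ∃ r t, 0 < r ∧ t ∈ Set.Ioo 0 Real.pi ∧ z = polarPoint √r (t / 2) := by
  have h1 : 0 < z.re := hz.1
  have h2 : 0 < z.im := hz.2
  have hz0 : z ≠ 0 := fun h => by simp [h] at h1
  have h3 := (Complex.abs_arg_lt_pi_div_two_iff.2 (Or.inl h1))
  have h4 : 0 < z.arg := by
    refine lt_of_le_of_ne (Complex.arg_nonneg_iff.2 h2.le) fun h => ?_
    exact h2.ne' (Complex.arg_eq_zero_iff.1 h.symm).2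
  refine ⟨‖z‖ ^ 2, 2 * z.arg, by positivity, ⟨by linarith, ?_⟩, ?_⟩
  · linarith [(abs_lt.1 h3).2]
  · rw [Real.sqrt_sq (norm_nonneg z), mul_div_cancel_left₀ _ two_ne_zero, polarPoint,
      Complex.norm_mul_exp_arg_mul_I]

/-! ### Enumeration of the zeros -/

namespace IsLevelAngle

variable {x y : ℕ → ℝ} {q : ℝ} {θ : ℝ → ℝ}

theorem splitProd_eq_zero_iff (h : IsLevelAngle x y q θ) (k : ℕ) {r t : ℝ} (hr : 0 < r)
    (ht : t ∈ Set.Ioo 0 Real.pi) :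
    splitProd x y q (quadrantPoint k (polarPoint √r (t / 2))) = 0 ↔
      t = θ r ∧ Complex.exp (levelArg x y θ r * Complex.I) =
        Complex.exp (targetArg k * Complex.I) := by
  rw [splitProd_quadrantPoint_eq_zero_iff h.x_nonneg h.x_summable h.y_nonneg h.y_summable,
    polarPoint_sq r t hr.le, h.eq_iff hr ht (Complex.norm_exp_ofReal_mul_I _)]

theorem mem_Ioo_of_eq_targetArg (h : IsLevelAngle x y q θ) {r : ℝ} (hr : 0 < r) {k : ℕ}
    (hA : levelArg x y θ r = targetArg k) : θ r ∈ Set.Ioo 0 Real.pi :=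
  h.mem_Ioo_of_exp_ne_one hr (by rw [hA]; exact exp_four_targetArg k)

theorem exists_eq_targetArg_of_lt (h : IsLevelAngle x y q θ) {k : ℕ} {r : ℝ} (hr : 0 < r)
    (hA : targetArg k < levelArg x y θ r) : ∃ s, 0 < s ∧ levelArg x y θ s = targetArg k := by
  obtain ⟨r', hr', hlt⟩ := h.exists_levelArg_lt
  have hk : -(Real.pi / 4) ≤ targetArg k := by
    rw [targetArg]
    have : 0 ≤ (k : ℝ) * (Real.pi / 2) := by positivity
    linarith
  have hsub : Set.uIcc r' r ⊆ Set.Ioi 0 := fun s hs => (lt_min hr' hr).trans_le hs.1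
  obtain ⟨s, hs, hsA⟩ := intermediate_value_uIcc (h.continuousOn_levelArg.mono hsub)
    (Set.mem_uIcc.2 (Or.inl ⟨(hlt.trans_le hk).le, hA.le⟩))
  exact ⟨s, hsub hs, hsA⟩

theorem targetArg_lt_succ (k : ℕ) : targetArg k < targetArg (k + 1) := by
  simp only [targetArg]
  push_cast
  linarith [Real.pi_pos]

theorem exists_eq_targetArg_zero (h : IsLevelAngle x y q θ) :
    ∃ s, 0 < s ∧ levelArg x y θ s = targetArg 0 := by
  obtain ⟨r, hr, hA⟩ := h.exists_lt_levelArg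
  exact h.exists_eq_targetArg_of_lt hr (by simpa [targetArg] using hA)

theorem lt_of_levelArg_lt (h : IsLevelAngle x y q θ) {k : ℕ} {r s : ℝ} (hs : 0 < s)
    (hrA : levelArg x y θ r = targetArg k)
    (hsA : levelArg x y θ s = targetArg (k + 1)) : r < s := by
  by_contra! hle
  have hlt := targetArg_lt_succ k
  rcases hle.eq_or_lt with heq | hlt'
  · rw [heq, hrA] at hsA
    linarith
  · have := h.lt_levelArg_of_le (exp_four_targetArg (k + 1)) hs hlt' hsA.ge
    linarith

theorem exists_isSimpleZeroList (h : IsLevelAngle x y q θ) :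
    ∃ ω z, IsSimpleZeroList (splitProd x y q) ω z ∧ z 0 ∈ quadrant 0 ∧
      ∀ (k : ℕ) (l : Fin 4), ((k + 1 : ℕ) : ℕ∞) < ω → z k ∈ quadrant l →
        z (k + 1) ∈ quadrant (l - 1) := by
  obtain ⟨ω, hω⟩ := exists_enat_lt_iff
    (K := fun k => ∃ s, 0 < s ∧ levelArg x y θ s = targetArg k) (by
      rintro k ⟨s, hs, hA⟩
      exact h.exists_eq_targetArg_of_lt hs (by rw [hA]; exact targetArg_lt_succ k))
  have hex : ∀ k : ℕ, ∃ s, (k : ℕ∞) < ω → 0 < s ∧ levelArg x y θ s = targetArg k := by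
    intro k
    by_cases hk : (k : ℕ∞) < ω
    · obtain ⟨s, hs⟩ := (hω k).1 hk
      exact ⟨s, fun _ => hs⟩
    · exact ⟨0, fun h => absurd h hk⟩
  choose s hs using hex
  have hlt_of_succ : ∀ k : ℕ, ((k + 1 : ℕ) : ℕ∞) < ω → (k : ℕ∞) < ω := fun k hk =>
    lt_of_le_of_lt (by exact_mod_cast k.le_succ) hk
  have h0 : ((0 : ℕ) : ℕ∞) < ω := (hω 0).2 h.exists_eq_targetArg_zero
  set p : ℕ → ℂ := fun k => polarPoint √(s k) (θ (s k) / 2)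
  have hp : ∀ k : ℕ, (k : ℕ∞) < ω → p k ∈ quadrant 0 := fun k hk =>
    polarPoint_half_mem_quadrant (hs k hk).1 (h.mem_Ioo_of_eq_targetArg (hs k hk).1 (hs k hk).2)
  have hzero : ∀ k : ℕ, (k : ℕ∞) < ω → splitProd x y q (quadrantPoint k (p k)) = 0 := fun k hk =>
    (h.splitProd_eq_zero_iff k (hs k hk).1
      (h.mem_Ioo_of_eq_targetArg (hs k hk).1 (hs k hk).2)).2 ⟨rfl, by rw [(hs k hk).2]⟩
  refine ⟨ω, fun k => quadrantPoint k (p k), ⟨?_, ?_, hzero, ?_, ?_, ?_, ?_⟩, ?_, ?_⟩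
  · exact fun a => (hasDerivAt_splitProd h.x_nonneg h.x_summable h.y_nonneg h.y_summable q
      a).differentiableAt
  · exact Order.one_le_iff_pos.2 (by exact_mod_cast h0)
  · exact fun k hk => deriv_splitProd_ne_zero h.x_nonneg h.x_summable h.y_nonneg h.y_summable
      h.exists_pos (im_quadrantPoint_sq_ne_zero (hp k hk) k) (hzero k hk)
  · intro a ha
    obtain ⟨j, z, hz, rfl⟩ := exists_quadrantPoint_eq (im_sq_ne_zero_of_splitProd_eq_zero
      h.x_nonneg h.x_summable h.y_nonneg h.y_summable h.q_pos ha)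
    obtain ⟨r, t, hr, ht, rfl⟩ := exists_polarPoint_of_mem_quadrant hz
    -- With the index reduced below 4, the integer n found next cannot be negative, and it goes back
    -- into the index as i + 4n.
    rw [← Nat.mod_add_div j 4, quadrantPoint_add_mul_four] at ha ⊢
    have hj : j % 4 < 4 := Nat.mod_lt _ (by norm_num)
    generalize j % 4 = i at ha hj ⊢
    obtain ⟨htθ, hexp⟩ := (h.splitProd_eq_zero_iff i hr ht).1 ha
    obtain ⟨n, hn⟩ := Complex.exp_eq_exp_iff_exists_int.1 hexp
    have hA : levelArg x y θ r = targetArg i + n * (2 * Real.pi) := by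
      have := congrArg Complex.im hn
      simpa using this
    have hlow := h.neg_angle_div_two_le_levelArg hr
    rw [← htθ] at hlow
    -- A ≥ -t/2 > -π/2, while n ≤ -1 and i ≤ 3 would give A ≤ -3π/4.
    have hn0 : 0 ≤ n := by
      by_contra! hneg
      have h1 : (n : ℝ) ≤ -1 := by exact_mod_cast (show n ≤ -1 by omega)
      have h2 : (i : ℝ) ≤ 3 := by exact_mod_cast Nat.lt_succ_iff.1 hj
      rw [hA, targetArg] at hlow
      nlinarith [ht.2, Real.pi_pos]
    obtain ⟨m, rfl⟩ := Int.eq_ofNat_of_zero_le hn0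
    have hA' : levelArg x y θ r = targetArg (i + 4 * m) := by
      rw [hA]
      simp only [targetArg]
      push_cast
      ring
    have hk : ((i + 4 * m : ℕ) : ℕ∞) < ω := (hω _).2 ⟨r, hr, hA'⟩
    refine ⟨i + 4 * m, hk, ?_⟩
    have hsr : s (i + 4 * m) = r := by
      obtain ⟨hs0, hsA⟩ := hs _ hk
      rcases lt_trichotomy (s (i + 4 * m)) r with hlt | heq | hlt
      · have := h.lt_levelArg_of_le (exp_four_targetArg _) hs0 hlt hsA.ge
        linarith
      · exact heq
      · have := h.lt_levelArg_of_le (exp_four_targetArg _) hr hlt hA'.ge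
        linarith
    simp only [p, hsr, quadrantPoint_add_mul_four, ← htθ]
  · intro k hk
    have hk' := hlt_of_succ k hk
    simp only [norm_quadrantPoint, p, norm_polarPoint, abs_of_nonneg (Real.sqrt_nonneg _)]
    exact Real.sqrt_lt_sqrt (hs k hk').1.le
      (h.lt_of_levelArg_lt (hs _ hk).1 (hs k hk').2 (hs _ hk).2)
  · exact fun k hk => im_quadrantPoint_sq_ne_zero (hp k hk) k
  · simpa [quadrantPoint] using hp 0 h0
  · exact fun k l hk hl => quadrantPoint_succ_mem (hp k (hlt_of_succ k hk)) (hp _ hk) k hl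

end IsLevelAngle

/-- The case X = Y = 1, where the gap does not depend on the angle and the level curve degenerates.
The only zero is e^{iπ/4}/q. -/
theorem exists_isSimpleZeroList_of_linear {q : ℝ} (hq : 0 < q) :
    ∃ z : ℕ → ℂ, IsSimpleZeroList
      (fun a => 1 - q * Complex.exp (-(Real.pi / 4) * Complex.I) * a) 1 z ∧ z 0 ∈ quadrant 0 := by
  set c := Complex.exp (-(Real.pi / 4) * Complex.I)
  have hqc : (q : ℂ) ≠ 0 := by exact_mod_cast hq.ne'
  have hc : c ≠ 0 := Complex.exp_ne_zero _
  set z₀ : ℂ := polarPoint q⁻¹ (Real.pi / 4)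
  have hz₀ : (q : ℂ) * c * z₀ = 1 := by
    simp only [c, z₀, polarPoint]
    rw [show (-(Real.pi / 4) * Complex.I : ℂ) = -((Real.pi / 4 : ℝ) * Complex.I) by push_cast; ring,
      Complex.exp_neg]
    have := Complex.exp_ne_zero ((Real.pi / 4 : ℝ) * Complex.I)
    push_cast
    field_simp
  have hmem : z₀ ∈ quadrant 0 := by
    constructor
    · rw [polarPoint_re, Real.cos_pi_div_four]; positivity
    · rw [polarPoint_im, Real.sin_pi_div_four]; positivity
  have hd : ∀ a, HasDerivAt (fun a : ℂ => 1 - q * c * a) (-(q * c)) a := fun a => by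
    simpa using ((hasDerivAt_id a).const_mul (q * c)).const_sub 1
  refine ⟨fun _ => z₀, ⟨fun a => (hd a).differentiableAt, le_rfl, fun k _ => ?_, fun k _ => ?_,
    fun a ha => ⟨0, by simp, ?_⟩, fun k hk => ?_, fun k _ => ?_⟩, hmem⟩
  · simp only [hz₀, sub_self]
  · rw [(hd _).deriv]
    exact neg_ne_zero.2 (mul_ne_zero hqc hc)
  · rw [sub_eq_zero, ← hz₀] at ha
    exact mul_left_cancel₀ (mul_ne_zero hqc hc) ha
  · exact absurd (show k + 1 < 1 by exact_mod_cast hk) (by omega)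
  · simpa [quadrantPoint] using im_quadrantPoint_sq_ne_zero hmem 0

theorem exists_isSimpleZeroList_splitProd {x y : ℕ → ℝ} (hx : ∀ k, 0 ≤ x k) (hxs : Summable x)
    (hy : ∀ k, 0 ≤ y k) (hys : Summable y) {q : ℝ} (hq : 0 < q) :
    ∃ ω z, IsSimpleZeroList (splitProd x y q) ω z ∧ z 0 ∈ quadrant 0 ∧
      ∀ (k : ℕ) (l : Fin 4), ((k + 1 : ℕ) : ℕ∞) < ω → z k ∈ quadrant l →
        z (k + 1) ∈ quadrant (l - 1) := by
  by_cases hpos : (∃ j, 0 < x j) ∨ ∃ j, 0 < y j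
  · obtain ⟨θ, hθ⟩ := exists_isLevelAngle hx hxs hy hys hq hpos
    exact hθ.exists_isSimpleZeroList
  · push Not at hpos
    have hx0 : x = 0 := funext fun k => le_antisymm (hpos.1 k) (hx k)
    have hy0 : y = 0 := funext fun k => le_antisymm (hpos.2 k) (hy k)
    obtain ⟨z, hz, hz0⟩ := exists_isSimpleZeroList_of_linear hq
    refine ⟨1, z, ?_, hz0, fun k l hk => absurd (show k + 1 < 1 by exact_mod_cast hk) (by omega)⟩
    convert hz using 1
    funext a
    simp [splitProd, hx0, hy0, canonicalProd]

/-! ### The rotated series and the main theorem -/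

theorem sign_mul_abs_self (r : ℝ) : Real.sign r * |r| = r := by
  rcases lt_trichotomy r 0 with h | rfl | h
  · rw [Real.sign_of_neg h, abs_of_neg h, neg_one_mul, neg_neg]
  · rw [abs_zero, mul_zero]
  · rw [Real.sign_of_pos h, abs_of_pos h, one_mul]

theorem I_pow_two_mul_mul_pred (k : ℕ) : Complex.I ^ (2 * (k * (k - 1))) = 1 := by
  rw [pow_mul, Complex.I_sq, (Nat.even_mul_pred_self k).neg_one_pow]

theorem I_pow_choose_two_even (k : ℕ) :
    Complex.I ^ (2 * k * (2 * k - 1) / 2) = Complex.I ^ k := by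
  have h : 2 * k * (2 * k - 1) / 2 = 2 * (k * (k - 1)) + k := by
    rw [mul_assoc, Nat.mul_div_cancel_left _ two_pos]
    cases k with
    | zero => rfl
    | succ k =>
      rw [show 2 * (k + 1) - 1 = 2 * k + 1 by omega, Nat.add_sub_cancel]
      ring
  rw [h, pow_add, I_pow_two_mul_mul_pred, one_mul]

theorem I_pow_choose_two_odd (k : ℕ) :
    Complex.I ^ ((2 * k + 1) * (2 * k + 1 - 1) / 2) = (-Complex.I) ^ k := by
  have h : (2 * k + 1) * (2 * k + 1 - 1) / 2 = 2 * (k * (k - 1)) + 3 * k := by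
    rw [Nat.add_sub_cancel, show (2 * k + 1) * (2 * k) = 2 * ((2 * k + 1) * k) by ring,
      Nat.mul_div_cancel_left _ two_pos]
    cases k with
    | zero => rfl
    | succ k =>
      rw [Nat.add_sub_cancel]
      ring
  rw [h, pow_add, I_pow_two_mul_mul_pred, one_mul, pow_mul, Complex.I_pow_three]

/-- At indices 2j and 2j + 1 the weight is i^j and (-i)^j, so weighting amounts to evaluating the
even part at iz² and the odd part at -iz². -/
theorem rotatedSeries_eq {f : ℕ → ℝ} (hf : ∀ z : ℂ, Summable fun k => (f k : ℂ) * z ^ k)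
    (α z : ℂ) : rotatedSeries α f z =
      α * (∑' k, (f (2 * k) : ℂ) * (Complex.I * z ^ 2) ^ k +
        z * ∑' k, (f (2 * k + 1) : ℂ) * (-(Complex.I * z ^ 2)) ^ k) := by
  have hs : ∀ w : ℂ, Summable fun k : ℕ => Complex.I ^ (k * (k - 1) / 2) * (f k : ℂ) * w ^ k :=
    fun w => (hf w).norm.of_norm_bounded fun k => by
      rw [mul_assoc, norm_mul, norm_pow, Complex.norm_I, one_pow, one_mul]
  rw [rotatedSeries, tsum_even_add_odd_mul_pow (fun w => (hs w).hasSum) z]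
  congr 2
  · refine tsum_congr fun k => ?_
    rw [I_pow_choose_two_even, mul_pow]
    ring
  · congr 1
    refine tsum_congr fun k => ?_
    rw [I_pow_choose_two_odd, ← neg_mul, mul_pow]
    ring

theorem rotatedSeriesConj_eq_conj (α : ℂ) (f : ℕ → ℝ) (z : ℂ) :
    rotatedSeriesConj α f z = conj (rotatedSeries α f (conj z)) := by
  rw [rotatedSeries, rotatedSeriesConj, map_mul, Complex.conj_tsum]
  congr 1
  refine tsum_congr fun k => ?_
  rw [map_mul, map_mul, map_pow, map_pow, Complex.conj_conj, Complex.conj_ofReal, Complex.conj_I,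
    ← inv_pow, Complex.inv_I]

theorem hasGenusAtMost_zero_const_mul_canonicalProd {x : ℕ → ℝ} (hx : ∀ k, 0 ≤ x k)
    (hxs : Summable x) {C : ℂ} (hC : C ≠ 0) (s : ℂ) :
    HasGenusAtMost 0 fun w => C * canonicalProd x (s * w) := by
  -- The constant C ≠ 0 is the exponential of a constant polynomial, and the reciprocals of the
  -- zeros are -xₖs.
  refine ⟨0, Polynomial.C (Complex.log C), fun k => -(x k * s), by simp, ?_, fun w => ?_⟩
  · have h : (fun k => ‖-((x k : ℂ) * s)‖ ^ (0 + 1)) = fun k => x k * ‖s‖ := by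
      funext k
      rw [zero_add, pow_one, norm_neg, norm_mul, Complex.norm_real, Real.norm_of_nonneg (hx k)]
    rw [h]
    exact hxs.mul_right _
  · refine ⟨canonicalProd x (s * w), ?_, by simp [Complex.exp_log hC]⟩
    convert hasProd_canonicalProd hx hxs (s * w) using 2 with k
    simp [weierstrassFactor]
    ring

theorem exists_eq_neg_of_canonicalProd_eq_zero {x : ℕ → ℝ} (hx : ∀ k, 0 ≤ x k)
    (hxs : Summable x) {w : ℂ} (hw : canonicalProd x w = 0) : ∃ r : ℝ, r < 0 ∧ w = r := by
  have h := mt (canonicalProd_ne_zero hx hxs (w := w)) (not_not.2 hw)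
  push Not at h
  exact ⟨w.re, h.2, Complex.ext rfl (by simpa using h.1)⟩

theorem exists_eq_mul_canonicalProd {E : ℂ → ℂ} (hE : Differentiable ℂ E) (h0 : E 0 ≠ 0)
    (hz : ∀ z, E z = 0 → ∃ x : ℝ, x < 0 ∧ z = x)
    (hgrow : ∀ ε > 0, ∃ C : ℝ, ∀ z, ‖E z‖ ≤ C * Real.exp (ε * ‖z‖)) :
    ∃ x : ℕ → ℝ, (∀ k, 0 ≤ x k) ∧ Summable x ∧ ∀ w, E w = E 0 * canonicalProd x w := by
  obtain ⟨x, hx, hxs, hprod⟩ := exists_hasProd_of_zeros_neg (g := fun w => (E 0)⁻¹ * E w)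
    (hE.const_mul _) (inv_mul_cancel₀ h0)
    (fun z h => hz z ((mul_eq_zero.1 h).resolve_left (inv_ne_zero h0))) (fun ε hε => by
      obtain ⟨C, hC⟩ := hgrow ε hε
      refine ⟨‖(E 0)⁻¹‖ * C, fun z => ?_⟩
      rw [norm_mul, mul_assoc]
      gcongr
      exact hC z)
  refine ⟨x, hx, hxs, fun w => ?_⟩
  rw [canonicalProd, (hprod w).tprod_eq, mul_inv_cancel_left₀ h0]

/-- The function `A (e X(z²) + ν z o Y(-z²))` with the canonical products `X`, `Y` of `x`, `y`. -/
noncomputable def splitForm (x y : ℕ → ℝ) (e o : ℝ) (A ν z : ℂ) : ℂ :=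
  A * (e * canonicalProd x (z ^ 2) + ν * z * (o * canonicalProd y (-z ^ 2)))

section splitForm

variable {x y : ℕ → ℝ} {e o : ℝ} {A ν : ℂ}

theorem conj_splitForm_conj (hx : ∀ k, 0 ≤ x k) (hxs : Summable x) (hy : ∀ k, 0 ≤ y k)
    (hys : Summable y) (e o : ℝ) (A ν z : ℂ) :
    conj (splitForm x y e o A ν (conj z)) = splitForm x y e o (conj A) (conj ν) z := by
  have hX := canonicalProd_conj hx hxs (z ^ 2)
  have hY := canonicalProd_conj hy hys (-z ^ 2)
  rw [map_neg, map_pow] at hY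
  rw [map_pow] at hX
  simp only [splitForm, hX, hY, map_mul, map_add, Complex.conj_conj, Complex.conj_ofReal]

theorem hasSplittingWithConstant_splitForm (hx : ∀ k, 0 ≤ x k) (hxs : Summable x)
    (hy : ∀ k, 0 ≤ y k) (hys : Summable y) (he : 0 < e) (ho : o ≠ 0) (hA : A ≠ 0)
    (hν : ‖ν‖ = 1) :
    HasSplittingWithConstant (splitForm x y e o A ν) (-(Real.sign o : ℂ) * ν) := by
  have hν0 : ν ≠ 0 := norm_ne_zero_iff.1 (by rw [hν]; exact one_ne_zero)
  have heC : (e : ℂ) ≠ 0 := by exact_mod_cast he.ne'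
  have hoC : (o : ℂ) ≠ 0 := by exact_mod_cast ho
  have hAe : A * e ≠ 0 := mul_ne_zero hA heC
  have hAo : A * ν * o ≠ 0 := mul_ne_zero (mul_ne_zero hA hν0) hoC
  refine ⟨fun w => A * e * canonicalProd x (1 * w), fun w => A * ν * o * canonicalProd y (-1 * w),
    hasGenusAtMost_zero_const_mul_canonicalProd hx hxs hAe 1,
    hasGenusAtMost_zero_const_mul_canonicalProd hy hys hAo (-1), fun z hz => ?_, fun z hz => ?_,
    fun z => ?_, ?_⟩
  · exact exists_eq_neg_of_canonicalProd_eq_zero hx hxs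
      (one_mul z ▸ (mul_eq_zero.1 hz).resolve_left hAe)
  · obtain ⟨r, hr, hzr⟩ := exists_eq_neg_of_canonicalProd_eq_zero hy hys
      ((mul_eq_zero.1 hz).resolve_left hAo)
    exact ⟨-r, neg_pos.2 hr, by rw [Complex.ofReal_neg, ← hzr]; ring⟩
  · simp only [splitForm, one_mul, neg_one_mul]
    ring
  · have hnA : (‖A‖ : ℂ) ≠ 0 := by exact_mod_cast norm_ne_zero_iff.2 hA
    have habs : ((|o| : ℝ) : ℂ) ≠ 0 := by exact_mod_cast abs_ne_zero.2 ho
    have hsign : (Real.sign o : ℂ) * (|o| : ℝ) = o := by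
      exact_mod_cast sign_mul_abs_self o
    have h1 : ∀ z : ℕ → ℝ, canonicalProd z 0 = 1 := fun z => by simp [canonicalProd]
    simp only [mul_zero, h1, mul_one, norm_mul, Complex.norm_real, Real.norm_eq_abs, hν,
      abs_of_pos he, Complex.ofReal_mul]
    rw [eq_div_iff (mul_ne_zero hAe (mul_ne_zero hnA habs)), ← hsign]
    ring

theorem neg_mem_quadrant {z : ℂ} {l : Fin 4} (hz : z ∈ quadrant l) : -z ∈ quadrant (l + 2) := by
  fin_cases l <;> simpa [quadrant] using hz

theorem conj_mem_quadrant {z : ℂ} {l : Fin 4} (hz : z ∈ quadrant l) :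
    conj z ∈ quadrant (3 - l) := by
  fin_cases l <;> simpa [quadrant] using hz

theorem exists_isSimpleZeroList_splitForm (hx : ∀ k, 0 ≤ x k) (hxs : Summable x)
    (hy : ∀ k, 0 ≤ y k) (hys : Summable y) (he : 0 < e) (ho : o ≠ 0) (hA : A ≠ 0)
    (hν : ν ^ 2 = -Complex.I) :
    ∃ ω z, IsSimpleZeroList (splitForm x y e o A ν) ω z ∧
      (∀ (k : ℕ) (l : Fin 4), ((k + 1 : ℕ) : ℕ∞) < ω → z k ∈ quadrant l →
        z (k + 1) ∈ quadrant (l - 1)) ∧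
      (-(Real.sign o : ℂ) * ν).im * (z 0).im < 0 ∧ 0 < (z 0).re * (z 0).im := by
  obtain ⟨ω, z, hz, hz0, hstep⟩ := exists_isSimpleZeroList_splitProd hx hxs hy hys
    (div_pos (abs_pos.2 ho) he)
  set c := Complex.exp (-(Real.pi / 4) * Complex.I) with hc
  have hc2 : ν ^ 2 = c ^ 2 := hν.trans exp_neg_pi_div_four_sq.symm
  have heC : (e : ℂ) ≠ 0 := by exact_mod_cast he.ne'
  have hsign : (Real.sign o : ℂ) * (|o| : ℝ) = o := by exact_mod_cast sign_mul_abs_self o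
  -- ν² = c² leaves ν = ±c. Together with the sign of o this is a single sign σ, absorbed by z ↦ σz.
  obtain ⟨σ, hσ, hσc⟩ : ∃ σ : ℝ, (σ = 1 ∨ σ = -1) ∧ -(Real.sign o : ℂ) * ν = σ * c := by
    rcases Real.sign_apply_eq_of_ne_zero o ho with h | h <;>
      rcases sq_eq_sq_iff_eq_or_eq_neg.1 hc2 with h' | h' <;> rw [h, h']
    · exact ⟨1, Or.inl rfl, by push_cast; ring⟩
    · exact ⟨-1, Or.inr rfl, by push_cast; ring⟩
    · exact ⟨-1, Or.inr rfl, by push_cast; ring⟩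
    · exact ⟨1, Or.inl rfl, by push_cast; ring⟩
  have hσ2 : (σ : ℂ) ^ 2 = 1 := by
    rcases hσ with rfl | rfl <;> norm_num
  have hF : splitForm x y e o A ν = fun a => A * e * splitProd x y (|o| / e) (σ * a) := by
    funext a
    have hoν : (o : ℂ) * ν = -((|o| : ℝ) * (σ * c)) := by rw [← hσc, ← hsign]; ring
    simp only [splitForm, splitProd, mul_pow, hσ2, one_mul, ← hc]
    push_cast
    field_simp
    linear_combination a * canonicalProd y (-a ^ 2) * hoν
  refine ⟨ω, fun k => σ * z k, hF ▸ hz.const_mul_comp_mul (mul_ne_zero hA heC) hσ2, ?_, ?_, ?_⟩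
  · intro k l hk hl
    rcases hσ with rfl | rfl
    · simp only [Complex.ofReal_one, one_mul] at hl ⊢
      exact hstep k l hk hl
    · simp only [Complex.ofReal_neg, Complex.ofReal_one, neg_one_mul] at hl ⊢
      have h1 := neg_mem_quadrant hl
      rw [neg_neg] at h1
      have h2 := neg_mem_quadrant (hstep k _ hk h1)
      have h3 : ∀ l : Fin 4, l + 2 - 1 + 2 = l - 1 := by decide
      rwa [h3] at h2
  · have h1 : 0 < (z 0).im := hz0.2
    have h2 : c.im = -(√2 / 2) := by rw [hc, exp_neg_pi_div_four]; simp
    rw [hσc, Complex.im_ofReal_mul, Complex.im_ofReal_mul, h2]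
    have h3 : (0 : ℝ) < √2 / 2 * (z 0).im := by positivity
    rcases hσ with rfl | rfl <;> linarith
  · have h1 : 0 < (z 0).re * (z 0).im := mul_pos hz0.1 hz0.2
    rw [Complex.re_ofReal_mul, Complex.im_ofReal_mul]
    rcases hσ with rfl | rfl <;> linarith

theorem clockwiseZeros_splitForm (hx : ∀ k, 0 ≤ x k) (hxs : Summable x)
    (hy : ∀ k, 0 ≤ y k) (hys : Summable y) (he : 0 < e) (ho : o ≠ 0) (hA : A ≠ 0)
    (hν : ν ^ 2 = -Complex.I) :
    ClockwiseZeros (splitForm x y e o A ν) (-(Real.sign o : ℂ) * ν) := by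
  obtain ⟨ω, z, hz, h⟩ := exists_isSimpleZeroList_splitForm hx hxs hy hys he ho hA hν
  exact ⟨ω, z, hz.separatedZeros, h⟩

/-- Conjugating both function and variable replaces ν by ν̄, whose square is -i, and reflects the
quadrants, which reverses the sense of rotation. -/
theorem counterclockwiseZeros_splitForm (hx : ∀ k, 0 ≤ x k) (hxs : Summable x)
    (hy : ∀ k, 0 ≤ y k) (hys : Summable y) (he : 0 < e) (ho : o ≠ 0) (hA : A ≠ 0)
    (hν : ν ^ 2 = Complex.I) :
    CounterclockwiseZeros (splitForm x y e o A ν) (-(Real.sign o : ℂ) * ν) := by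
  obtain ⟨ω, z, hz, hstep, him, hpos⟩ := exists_isSimpleZeroList_splitForm (A := conj A)
    (ν := conj ν) hx hxs hy hys he ho ((map_ne_zero _).2 hA)
    (by rw [← map_pow, hν, Complex.conj_I])
  have hF : splitForm x y e o A ν =
      fun a => conj (splitForm x y e o (conj A) (conj ν) (conj a)) := by
    funext a
    rw [conj_splitForm_conj hx hxs hy hys, Complex.conj_conj, Complex.conj_conj]
  refine ⟨ω, fun k => conj (z k), hF ▸ hz.conj_comp_conj.separatedZeros, fun k l hk hl => ?_,
    ?_, ?_⟩
  · have h1 := conj_mem_quadrant hl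
    rw [Complex.conj_conj] at h1
    have h2 := conj_mem_quadrant (hstep k _ hk h1)
    have h3 : ∀ l : Fin 4, 3 - (3 - l - 1) = l + 1 := by decide
    rwa [h3] at h2
  · have hre : ν.re = ν.im := by
      have h1 := congrArg Complex.re hν
      have h2 := congrArg Complex.im hν
      simp only [sq, Complex.mul_re, Complex.mul_im, Complex.I_re, Complex.I_im] at h1 h2
      have h3 : (ν.re - ν.im) * (ν.re + ν.im) = 0 := by linarith
      rcases mul_eq_zero.1 h3 with h | h
      · linarith
      · nlinarith [sq_nonneg ν.re]
    simp only [← Complex.ofReal_neg, Complex.re_ofReal_mul, Complex.im_ofReal_mul,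
      Complex.conj_re, Complex.conj_im] at him ⊢
    rw [hre]
    by_contra! hle
    nlinarith [mul_pos_of_neg_of_neg him (neg_lt_zero.2 hpos), sq_nonneg (z 0).im]
  · simpa using hpos

end splitForm

theorem mainTheorem3 (f : ℕ → ℝ) (Ft : ℂ → ℂ)
    (hFt : ∀ z : ℂ, HasSum (fun k : ℕ => (f k : ℂ) * z ^ k) (Ft z))
    (hgenus : HasGenusAtMost 1 Ft) (hf0 : 0 < f 0)
    (heven : ∀ z : ℂ, ∑' k : ℕ, (f (2 * k) : ℂ) * z ^ k = 0 → ∃ x : ℝ, x < 0 ∧ z = x)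
    (hodd : ∀ z : ℂ, ∑' k : ℕ, (f (2 * k + 1) : ℂ) * z ^ k = 0 → ∃ x : ℝ, x < 0 ∧ z = x)
    (α : ℂ) (hα : α ≠ 0) (μ : ℂ) (hμ : μ ^ 2 = Complex.I) :
    (HasSplittingWithConstant (fun z => rotatedSeries α f (conj μ * z))
        (-(Real.sign (f 1) : ℂ) * conj μ) ∧
      ClockwiseZeros (fun z => rotatedSeries α f (conj μ * z))
        (-(Real.sign (f 1) : ℂ) * conj μ)) ∧
    (HasSplittingWithConstant (fun z => rotatedSeriesConj α f (μ * z))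
        (-(Real.sign (f 1) : ℂ) * μ) ∧
      CounterclockwiseZeros (fun z => rotatedSeriesConj α f (μ * z))
        (-(Real.sign (f 1) : ℂ) * μ)) := by
  have hs : ∀ w : ℂ, Summable fun k => (f k : ℂ) * w ^ k := fun w => (hFt w).summable
  obtain ⟨E, hEdef⟩ : ∃ E : ℂ → ℂ, E = fun w => ∑' k, (f (2 * k) : ℂ) * w ^ k := ⟨_, rfl⟩
  obtain ⟨O, hOdef⟩ : ∃ O : ℂ → ℂ, O = fun w => ∑' k, (f (2 * k + 1) : ℂ) * w ^ k := ⟨_, rfl⟩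
  have hEz : ∀ z, E z = 0 → ∃ r : ℝ, r < 0 ∧ z = r := by rwa [hEdef]
  have hOz : ∀ z, O z = 0 → ∃ r : ℝ, r < 0 ∧ z = r := by rwa [hOdef]
  have hE : Differentiable ℂ E := by
    rw [hEdef]
    exact differentiable_tsum_mul_pow (summable_even_of_summable (a := fun k => (f k : ℂ)) hs)
  have hO : Differentiable ℂ O := by
    rw [hOdef]
    exact differentiable_tsum_mul_pow (summable_odd_of_summable (a := fun k => (f k : ℂ)) hs)
  have hE0 : E 0 = f 0 := by
    simp only [hEdef]
    rw [tsum_eq_single 0 fun k hk => by rw [zero_pow hk, mul_zero], pow_zero, mul_one, mul_zero]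
  have hO0 : O 0 = f 1 := by
    simp only [hOdef]
    rw [tsum_eq_single 0 fun k hk => by rw [zero_pow hk, mul_zero], pow_zero, mul_one, mul_zero,
      zero_add]
  -- Otherwise 0 would be a zero of O, and it is not negative.
  have hf1 : f 1 ≠ 0 := by
    intro h
    obtain ⟨r, hr, h0⟩ := hOz 0 (by rw [hO0, h, Complex.ofReal_zero])
    exact hr.ne (Complex.ofReal_eq_zero.1 h0.symm)
  have hsplit : ∀ z, Ft z = E (z ^ 2) + z * O (z ^ 2) := by
    rw [hEdef, hOdef]
    exact tsum_even_add_odd_mul_pow (a := fun k => (f k : ℂ)) hFt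
  have hgrow : ∀ ε > 0, ∃ C : ℝ, ∀ z, ‖Ft z‖ ≤ C * Real.exp (ε * ‖z‖ ^ 2) := fun ε hε =>
    hgenus.exists_norm_le_exp_sq hε
  obtain ⟨x, hx, hxs, hEx⟩ := exists_eq_mul_canonicalProd hE
    (by rw [hE0]; exact_mod_cast hf0.ne') hEz (exists_even_norm_le_exp hsplit hgrow)
  obtain ⟨y, hy, hys, hOy⟩ := exists_eq_mul_canonicalProd hO
    (by rw [hO0]; exact_mod_cast hf1) hOz 
    (exists_odd_norm_le_exp hsplit hO.continuous hgrow)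
  rw [hE0] at hEx
  rw [hO0] at hOy
  have hμ' : conj μ ^ 2 = -Complex.I := by rw [← map_pow, hμ, Complex.conj_I]
  have hμn : ‖μ‖ = 1 := by
    have h := congrArg norm hμ
    rw [norm_pow, Complex.norm_I] at h
    exact (pow_eq_one_iff_of_nonneg (norm_nonneg _) two_ne_zero).1 h
  have ha : ∀ z, rotatedSeries α f (conj μ * z) = splitForm x y (f 0) (f 1) α (conj μ) z := by
    intro z
    -- The rotation is chosen so that the arguments iz² and -iz² of the two parts become z² and -z².
    have hI : Complex.I * (conj μ * z) ^ 2 = z ^ 2 := by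
      rw [mul_pow, hμ', ← mul_assoc, mul_neg, Complex.I_mul_I, neg_neg, one_mul]
    rw [rotatedSeries_eq hs, hI, splitForm, ← hEx, ← hOy, hEdef, hOdef]
  have hb : ∀ z, rotatedSeriesConj α f (μ * z) = splitForm x y (f 0) (f 1) (conj α) μ z := by
    intro z
    rw [rotatedSeriesConj_eq_conj, map_mul, ha, conj_splitForm_conj hx hxs hy hys,
      Complex.conj_conj]
  rw [funext ha, funext hb]
  have hα' : conj α ≠ 0 := (map_ne_zero _).2 hα
  exact ⟨⟨hasSplittingWithConstant_splitForm hx hxs hy hys hf0 hf1 hα (by rwa [RCLike.norm_conj]),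
      clockwiseZeros_splitForm hx hxs hy hys hf0 hf1 hα hμ'⟩,
    hasSplittingWithConstant_splitForm hx hxs hy hys hf0 hf1 hα' hμn,
    counterclockwiseZeros_splitForm hx hxs hy hys hf0 hf1 hα' hμ⟩
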